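/- Let $R$ be a noetherian local integral domain with fraction field $K\neq R$ (that is, $R$ is not a field). Let $M$ be an $R$-module which is complemented: for every submodule $U\subseteq M$, the set $\{V\subseteq M \mid V+U=M\}$ of submodules has a minimal element (an addition complement of $U$ in $M$). Let $D(M)$ be the largest divisible submodule of $M$, where an $R$-module $D$ is called divisible if $rD=D$ for every $0\neq r\in R$. Then there are submodules $M_1,M_2\subseteq M$ with $$M=M_1+M_2+D(M),$$ where $M_1$ is bounded, i.e. $rM_1=0$ for some $0\neq r\in R$, and $M_2$ is finitely generated. Moreover there are submodules $D_1,D_2\subseteq D(M)$ and an integer $n\geq 0$ such that $D(M)=D_1\oplus D_2$ (internal direct sum), $D_1$ is artinian and $D_2\cong K^n$ as $R$-modules. -/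

import Mathlib

namespace SupplementedModule

/-- `V` is an (addition) complement of `U` in `M`: it is minimal among the submodules `V'`
of `M` with `V' + U = M`. -/
def IsComplementOf {R M : Type*} [CommRing R] [AddCommGroup M] [Module R M]
    (V U : Submodule R M) : Prop :=
  Minimal (fun V' : Submodule R M => V' ⊔ U = ⊤) V

/-- A module is complemented if each of its submodules has an (addition) complement. -/
def IsComplemented (R M : Type*) [CommRing R] [AddCommGroup M] [Module R M] : Prop :=
  ∀ U : Submodule R M, ∃ V : Submodule R M, IsComplementOf V U

/-- A module is bounded if it is annihilated by some nonzero ring element. -/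
def IsBounded (R M : Type*) [CommRing R] [AddCommGroup M] [Module R M] : Prop :=
  ∃ r : R, r ≠ 0 ∧ ∀ x : M, r • x = 0

/-- A module over an integral domain is divisible if `r M = M` for each nonzero `r`. -/
def IsDivisible (R M : Type*) [CommRing R] [IsDomain R] [AddCommGroup M] [Module R M] : Prop :=
  ∀ r : R, r ≠ 0 → ∀ x : M, ∃ y : M, r • y = x

/-- The divisible part `D(M)` of `M`: the sum of all divisible submodules of `M`. -/
def divisiblePart (R M : Type*) [CommRing R] [IsDomain R] [AddCommGroup M] [Module R M] :
    Submodule R M :=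
  sSup {N : Submodule R M | IsDivisible R N}

/-- `D(M)` is the largest divisible submodule of `M`. -/
theorem isGreatest_divisiblePart (R M : Type*) [CommRing R] [IsDomain R] [AddCommGroup M]
    [Module R M] : IsGreatest {N : Submodule R M | IsDivisible R N} (divisiblePart R M) := by
  refine ⟨fun r hr x => ?_, fun N hN => le_sSup hN⟩
  have key : divisiblePart R M ≤ (divisiblePart R M).map (LinearMap.lsmul R M r) := by
    refine sSup_le fun N hN x hx => ?_
    obtain ⟨y, hy⟩ := hN r hr ⟨x, hx⟩
    exact ⟨y, le_sSup (a := N) hN y.2, by simpa using congrArg Subtype.val hy⟩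
  obtain ⟨y, hy, hyx⟩ := key x.2
  exact ⟨⟨y, hy⟩, Subtype.ext hyx⟩

end SupplementedModule

/-!
The proof first reduces the theorem to a submodule `V` of `M` with three properties: `c V` is
finitely generated for some `c ≠ 0`, `M ⧸ V` is artinian, and `V + D(M) = M`
(`IsComplemented.exists_sup_divisiblePart_eq_top`). The submodule `V` splits at once into a
bounded and a finitely generated part (`exists_bounded_sup_fg_eq`).

To find `V`, fix `0 ≠ r ∈ 𝔪` and let `V₀` be a complement of `rM`. Then `rV₀` is small in `V₀`.
This forces some `rᵉ V₀` to be finitely generated (`exists_sup_range_lsmul_eq_top`), because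
otherwise `V₀` has a subdirectly irreducible, hence artinian quotient not annihilated by any power
of `r`. On the other hand `M ⧸ V₀` is complemented and `r` acts surjectively on it, and the core
of the proof, `IsComplemented.exists_fg_isArtinian_quotient`, says that such a module `N` is
artinian modulo a finitely generated submodule. These two facts give a submodule `V₁ ⊇ V₀` with
`rᵉ V₁` finitely generated and `M ⧸ V₁` artinian. Choosing `r₀ ≠ 0` with `r₀ (M ⧸ V₁)` minimal
makes this module divisible, and `V = {x | r₀ x ∈ V₁}` has the required properties, since any
complement of `V` is divisible.

For the core, let `E` be the injective hull of the residue field, an artinian module with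
commutative endomorphism ring. The values of homomorphisms `f : N → E` which persist when `f` has
to vanish on arbitrary finitely generated submodules, and the argument has to lie in arbitrary
submodules with artinian quotient, form a submodule of `E`, the stable values (`stableValues`).
All values are stable once `f` and the argument satisfy suitable conditions of this kind. If no
nonzero value is stable, the injectivity of `E` shows that a submodule with artinian quotient is
contained in a finitely generated one. To see that there are no nonzero stable values, one
realises them by independent homomorphisms on an increasing sequence of submodules with union `U`,
and adds up infinitely many of these into a homomorphism `g : N → E` which takes all stable values
already on `V ∩ U`, for a complement `V` of `U`. The commutativity of the endomorphism ring of `E`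
allows `g` to be chosen with stable values only. Then `V ∩ ker g` is still a supplement of `U`, so
that `g` vanishes on `V`.

For the second part, `D = D(M)` is artinian modulo a finitely generated submodule `F`. The torsion
submodule of `D` is a homomorphic image of a submodule of `D ⧸ F`, hence artinian. This makes it
possible to extend each homomorphism `R → D` to `K`, by a compactness argument for cosets of
artinian modules (`exists_forall_smul_eq`). A maximal linearly independent set of elements of `F`
thus defines an embedding `Kⁿ → D`, whose image is a complement of the torsion submodule.
-/

namespace SupplementedModule

open IsLocalRing

/-! ### Complements and quotients -/

theorem IsComplemented.of_surjective {R M N : Type*} [CommRing R] [AddCommGroup M] [Module R M]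
    [AddCommGroup N] [Module R N] (hM : IsComplemented R M) (f : M →ₗ[R] N)
    (hf : Function.Surjective f) : IsComplemented R N := by
  intro U
  obtain ⟨V, hV, hmin⟩ := hM (U.comap f)
  refine ⟨V.map f, ?_, fun Y hY hle => ?_⟩
  · refine eq_top_iff.2 fun y _ => ?_
    obtain ⟨x, rfl⟩ := hf y
    obtain ⟨v, hv, u, hu, rfl⟩ := Submodule.mem_sup.1 (hV.ge (Submodule.mem_top (x := x)))
    rw [map_add]
    exact Submodule.add_mem_sup (Submodule.mem_map_of_mem hv) hu
  · have key : V ≤ V ⊓ Y.comap f := by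
      refine hmin (eq_top_iff.2 fun x _ => ?_) inf_le_left
      obtain ⟨y, hy, u, hu, hyu⟩ := Submodule.mem_sup.1 (hY.ge (Submodule.mem_top (x := f x)))
      obtain ⟨v, hv, rfl⟩ := hle hy
      rw [← add_sub_cancel v x]
      refine Submodule.add_mem_sup ⟨hv, hy⟩ ?_
      rw [Submodule.mem_comap, map_sub, ← hyu, add_sub_cancel_left]
      exact hu
    rintro _ ⟨v, hv, rfl⟩
    exact (key hv).2

/-- If `M = r M + U`, then `r V = V` for a complement `V` of `U`, since `r V + U = M`. -/
theorem IsComplementOf.smul_surjective {R M : Type*} [CommRing R] [AddCommGroup M] [Module R M]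
    {U V : Submodule R M} (h : IsComplementOf V U) {r : R}
    (hr : ∀ x : M, ∃ y : M, x - r • y ∈ U) : V ≤ V.map (LinearMap.lsmul R M r) := by
  refine h.2 (eq_top_iff.2 fun x _ => ?_) ?_
  · obtain ⟨y, hy⟩ := hr x
    obtain ⟨v, hv, u, hu, rfl⟩ := Submodule.mem_sup.1 (h.1.ge (Submodule.mem_top (x := y)))
    refine Submodule.mem_sup.2 ⟨r • v, ⟨v, hv, rfl⟩, x - r • v, ?_, by abel⟩
    have : x - r • v = (x - r • (v + u)) + r • u := by rw [smul_add]; abel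
    rw [this]
    exact U.add_mem hy (U.smul_mem r hu)
  · rintro _ ⟨v, hv, rfl⟩
    exact V.smul_mem r hv

/-! ### Artinian modules over noetherian local rings -/

section Artinian

variable {R A : Type*} [CommRing R] [AddCommGroup A] [Module R A]

/-- The proof runs like Hilbert's basis theorem: a submodule `B` is recorded by the submodules
`xⁿ B ∩ A[x]` of `A[x]`, which determine it among its submodules. -/
theorem isArtinian_of_ker_lsmul {x : R} (htor : ∀ a : A, ∃ n : ℕ, x ^ n • a = 0)
    (h : IsArtinian R (LinearMap.ker (LinearMap.lsmul R A x))) : IsArtinian R A := by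
  rw [← monotone_stabilizes_iff_artinian]
  intro B
  -- `C i n` is `xⁿ B i ∩ A[x]`, decreasing in `i` and in `n`
  let C : ℕ → ℕ → Submodule R (LinearMap.ker (LinearMap.lsmul R A x)) := fun i n =>
    (Submodule.map (LinearMap.lsmul R A (x ^ n)) (OrderDual.ofDual (B i))).comap
      (Submodule.subtype _)
  have hBanti : ∀ {i j}, i ≤ j → OrderDual.ofDual (B j) ≤ OrderDual.ofDual (B i) :=
    fun hij => B.monotone hij
  have hC1 : ∀ {i j} (n), i ≤ j → C j n ≤ C i n := fun n hij =>
    Submodule.comap_mono (Submodule.map_mono (hBanti hij))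
  have hC2 : ∀ (i) {n k}, n ≤ k → C i k ≤ C i n := by
    rintro i n k hnk y ⟨b, hb, hby⟩
    refine ⟨x ^ (k - n) • b, Submodule.smul_mem _ _ hb, ?_⟩
    rw [← hby]
    simp only [LinearMap.lsmul_apply, smul_smul, ← pow_add]
    rw [Nat.add_sub_cancel' hnk]
  obtain ⟨k, hk⟩ := monotone_stabilizes_iff_artinian.2 h
    ⟨fun i => OrderDual.toDual (C i i), fun i j hij =>
      (hC1 _ hij).trans (hC2 _ hij : C i j ≤ C i i)⟩
  have hk' : ∀ m, k ≤ m → C m m = C k k := fun m hm => (hk m hm).symm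
  have hcol : ∀ n, ∃ i₀, ∀ i, i₀ ≤ i → C i n = C i₀ n := by
    intro n
    obtain ⟨i₀, h0⟩ := monotone_stabilizes_iff_artinian.2 h
      ⟨fun i => OrderDual.toDual (C i n), fun i j hij => hC1 n hij⟩
    exact ⟨i₀, fun i hi => (h0 i hi).symm⟩
  choose i₀ hi₀ using hcol
  let K := k + ∑ n ∈ Finset.range k, i₀ n
  have hK : ∀ n i, K ≤ i → C i n = C K n := by
    intro n i hi
    rcases lt_or_ge n k with hn | hn
    · have : i₀ n ≤ K := le_trans
        (Finset.single_le_sum (fun _ _ => Nat.zero_le _) (Finset.mem_range.2 hn))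
        (Nat.le_add_left _ _)
      rw [hi₀ n i (this.trans hi), hi₀ n K this]
    · have aux : ∀ j, k ≤ j → C j n = C k k := fun j hj =>
        le_antisymm ((hC1 n hj).trans (hC2 k hn))
          ((hk' (max j n) (hj.trans (le_max_left _ _))).ge.trans
            ((hC2 _ (le_max_right _ _)).trans (hC1 _ (le_max_left _ _))))
      rw [aux i ((Nat.le_add_right _ _).trans hi), aux K (Nat.le_add_right _ _)]
  refine ⟨K, fun i hi => ?_⟩
  refine le_antisymm (B.monotone hi) ?_
  change OrderDual.ofDual (B K) ≤ OrderDual.ofDual (B i)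
  have key : ∀ n : ℕ, ∀ b ∈ OrderDual.ofDual (B K), x ^ n • b = 0 → b ∈ OrderDual.ofDual (B i) := by
    intro n
    induction n with
    | zero =>
      intro b _ h0
      rw [pow_zero, one_smul] at h0
      exact h0 ▸ zero_mem _
    | succ n ih =>
      intro b hb h0
      have hmem : (⟨x ^ n • b, by
          rw [LinearMap.mem_ker, LinearMap.lsmul_apply, smul_smul, ← pow_succ', h0]⟩ :
          LinearMap.ker (LinearMap.lsmul R A x)) ∈ C K n := ⟨b, hb, rfl⟩
      rw [← hK n i hi] at hmem
      obtain ⟨b', hb', hbb'⟩ := hmem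
      have : b - b' ∈ OrderDual.ofDual (B i) :=
        ih _ (sub_mem hb (hBanti hi hb')) (by
          rw [smul_sub, sub_eq_zero]; exact hbb'.symm)
      simpa using add_mem this hb'
  intro b hb
  obtain ⟨n, hn⟩ := htor b
  exact key n b hb hn

/-- If each element of a finite set `t` acts locally nilpotently on `A`, then `A` is artinian as
soon as the common annihilator of `t` in `A` is. -/
theorem isArtinian_of_finset (t : Finset R) : ∀ {A : Type*} [AddCommGroup A] [Module R A],
    (∀ x ∈ t, ∀ a : A, ∃ n : ℕ, x ^ n • a = 0) →
    ∀ S : Submodule R A, IsArtinian R S → (∀ a, (∀ x ∈ t, x • a = 0) → a ∈ S) →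
    IsArtinian R A := by
  classical
  induction t using Finset.induction with
  | empty =>
    intro A _ _ _ S hS h
    exact isArtinian_of_injective (LinearMap.id.codRestrict S fun a => h a (by simp))
      fun a b hab => congrArg Subtype.val hab
  | insert x t hx ih =>
    intro A _ _ htor S hS h
    refine isArtinian_of_ker_lsmul (htor x (Finset.mem_insert_self _ _)) ?_
    refine ih (fun y hy a => ?_) (S.comap (Submodule.subtype _)) ?_ fun a ha => ?_
    · obtain ⟨n, hn⟩ := htor y (Finset.mem_insert_of_mem hy) a
      exact ⟨n, Subtype.ext hn⟩
    · refine isArtinian_of_injective (((Submodule.subtype _).comp (Submodule.subtype _)).codRestrict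
        S fun a => a.2) fun a b hab => Subtype.ext (Subtype.ext (congrArg S.subtype hab))
    · refine h _ fun y hy => ?_
      rcases Finset.mem_insert.1 hy with rfl | hy
      · exact a.2
      · exact congrArg Subtype.val (ha y hy)

theorem isSimpleModule_span_singleton {s : A} (hs : s ≠ 0) (h : ∀ x : A, x ≠ 0 → s ∈ R ∙ x) :
    IsSimpleModule R (R ∙ s) := by
  rw [isSimpleModule_iff_toSpanSingleton_surjective]
  refine ⟨⟨⟨s, Submodule.mem_span_singleton_self s⟩, 0, fun h0 => hs (congrArg Subtype.val h0)⟩,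
    fun y hy z => ?_⟩
  obtain ⟨c, hc⟩ := Submodule.mem_span_singleton.1 (h y fun h0 => hy (Subtype.ext h0))
  obtain ⟨d, hd⟩ := Submodule.mem_span_singleton.1 z.2
  exact ⟨d * c, Subtype.ext (by simp [mul_smul, hc, hd])⟩

section LocalRing

variable [IsLocalRing R]

theorem isNoetherian_of_isArtinian_of_pow_smul [IsNoetherianRing R] [IsArtinian R A] {n : ℕ}
    (h : ∀ c ∈ maximalIdeal R ^ n, ∀ a : A, c • a = 0) : IsNoetherian R A := by
  have hT : Module.IsTorsionBySet R A (maximalIdeal R ^ n : Ideal R) := fun a c => h c c.2 a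
  let _ := hT.module
  let e : A →ₛₗ[Ideal.Quotient.mk (maximalIdeal R ^ n)] A := ⟨.id _, fun _ _ => rfl⟩
  rw [e.isNoetherian_iff_of_bijective Function.bijective_id]
  have h2 : IsArtinian (R ⧸ maximalIdeal R ^ n) A :=
    (e.isArtinian_iff_of_bijective Function.bijective_id).1 inferInstance
  rcases eq_or_ne n 0 with rfl | hn
  · have : Subsingleton A := ⟨fun a b => by
      have := fun a : A => h 1 (by simp) a
      simp only [one_smul] at this
      rw [this a, this b]⟩
    infer_instance
  have : IsLocalRing (R ⧸ maximalIdeal R ^ n) :=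
    haveI : Nontrivial (R ⧸ maximalIdeal R ^ n) := Ideal.Quotient.nontrivial_iff.2
      (ne_top_of_le_ne_top (Ideal.IsPrime.ne_top inferInstance) (Ideal.pow_le_self hn))
    IsLocalRing.of_surjective' _ Ideal.Quotient.mk_surjective
  have h3 : IsArtinianRing (R ⧸ maximalIdeal R ^ n) := by
    rw [isArtinianRing_iff_isNilpotent_maximalIdeal]
    refine ⟨n, ?_⟩
    have : maximalIdeal (R ⧸ maximalIdeal R ^ n) =
        (maximalIdeal R).map (Ideal.Quotient.mk (maximalIdeal R ^ n)) :=
      (IsLocalRing.map_maximalIdeal_of_surjective _ Ideal.Quotient.mk_surjective).symm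
    rw [this, ← Ideal.map_pow, Ideal.map_quotient_self]
    rfl
  exact IsSemiprimaryRing.isNoetherian_iff_isArtinian.2 h2

theorem exists_pow_smul_eq_zero_of_isArtinian [IsArtinian R A] {r : R} (hr : r ∈ maximalIdeal R)
    (a : A) : ∃ n : ℕ, r ^ n • a = 0 := by
  obtain ⟨n, ⟨y, hyspan⟩, hy⟩ := IsArtinian.exists_pow_succ_smul_dvd r
    (⟨a, Submodule.mem_span_singleton_self a⟩ : R ∙ a)
  obtain ⟨b, rfl⟩ := Submodule.mem_span_singleton.1 hyspan
  have hy' : r ^ (n + 1) • b • a = r ^ n • a := congrArg Subtype.val hy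
  have hu : IsUnit (1 - b * r) := isUnit_one_sub_self_of_mem_nonunits _ (Ideal.mul_mem_left _ b hr)
  refine ⟨n, hu.smul_eq_zero.1 ?_⟩
  have : (1 - b * r) • r ^ n • a = r ^ n • a - r ^ (n + 1) • b • a := by
    rw [sub_smul, one_smul, smul_smul, smul_smul]
    congr 2
    ring
  rw [this, hy', sub_self]

/-! ### Subdirectly irreducible modules -/

section SubdirectlyIrreducible

variable {s : A}

theorem smul_eq_zero_of_mem_span (h : ∀ x : A, x ≠ 0 → s ∈ R ∙ x) {c : R}
    (hc : c ∈ maximalIdeal R) : c • s = 0 := by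
  by_contra h0
  obtain ⟨b, hb⟩ := Submodule.mem_span_singleton.1 (h _ h0)
  have hu : IsUnit (1 - b * c) :=
    isUnit_one_sub_self_of_mem_nonunits _ (Ideal.mul_mem_left _ b hc)
  have : (1 - b * c) • s = 0 := by rw [sub_smul, one_smul, mul_smul, hb, sub_self]
  exact h0 (by rw [hu.smul_eq_zero.1 this, smul_zero])

variable [IsNoetherianRing R]

/-- By Krull's intersection theorem, `s ∉ 𝔪ⁿ x` for some `n`, and then `𝔪ⁿ x = 0`. -/
theorem exists_mem_torsionBySet (hs : s ≠ 0) (h : ∀ x : A, x ≠ 0 → s ∈ R ∙ x) (x : A) :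
    ∃ n : ℕ, x ∈ Submodule.torsionBySet R A (maximalIdeal R ^ n : Ideal R) := by
  by_contra! hcon
  have hK := Ideal.iInf_pow_smul_eq_bot_of_isLocalRing (M := R ∙ x) (maximalIdeal R)
    (Ideal.IsPrime.ne_top inferInstance)
  have hx : x ≠ 0 := by
    rintro rfl
    exact hcon 0 (zero_mem _)
  have : (⟨s, h x hx⟩ : R ∙ x) ∈ (⨅ i : ℕ, maximalIdeal R ^ i • ⊤ : Submodule R (R ∙ x)) := by
    rw [Submodule.mem_iInf]
    intro n
    have hn := hcon n
    rw [Submodule.mem_torsionBySet_iff] at hn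
    push Not at hn
    obtain ⟨⟨c, hc⟩, hcx⟩ := hn
    obtain ⟨b, hb⟩ := Submodule.mem_span_singleton.1 (h _ hcx)
    have : (⟨s, h x hx⟩ : R ∙ x) = c • (b • ⟨x, Submodule.mem_span_singleton_self x⟩) :=
      Subtype.ext (by simp only [SetLike.val_smul]; rw [smul_comm c b]; exact hb.symm)
    rw [this]
    exact Submodule.smul_mem_smul hc Submodule.mem_top
  rw [hK, Submodule.mem_bot] at this
  exact hs (congrArg Subtype.val this)

theorem isArtinian_of_mem_span (hs : s ≠ 0) (h : ∀ x : A, x ≠ 0 → s ∈ R ∙ x) :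
    IsArtinian R A := by
  obtain ⟨t, ht⟩ := (isNoetherianRing_iff_ideal_fg R).1 inferInstance (maximalIdeal R)
  refine isArtinian_of_finset t (fun x hx a => ?_) (R ∙ s) ?_ fun a ha => ?_
  · obtain ⟨n, hn⟩ := exists_mem_torsionBySet hs h a
    rw [Submodule.mem_torsionBySet_iff] at hn
    exact ⟨n, hn ⟨x ^ n, Ideal.pow_mem_pow (ht ▸ Submodule.subset_span hx) n⟩⟩
  · have := isSimpleModule_span_singleton hs h
    infer_instance
  · rcases eq_or_ne a 0 with rfl | ha0
    · exact zero_mem _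
    obtain ⟨c, hc⟩ := Submodule.mem_span_singleton.1 (h a ha0)
    by_cases hcm : c ∈ maximalIdeal R
    · have : maximalIdeal R ≤ LinearMap.ker (LinearMap.toSpanSingleton R A a) := by
        rw [← ht, Submodule.span_le]
        exact fun x hx => ha x hx
      exact absurd (hc.symm.trans (this hcm)) hs
    · have hu : IsUnit c := by simpa using hcm
      obtain ⟨u, rfl⟩ := hu
      refine Submodule.mem_span_singleton.2 ⟨(u⁻¹ : Rˣ), ?_⟩
      rw [← hc, smul_smul, Units.inv_mul, one_smul]

end SubdirectlyIrreducible

end LocalRing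

/-! ### Small multiples -/

theorem exists_le_forall_mkQ_mem_span {F : Submodule R A} {s : A} (hs : s ∉ F) :
    ∃ Y : Submodule R A, F ≤ Y ∧ s ∉ Y ∧ ∀ x : A ⧸ Y, x ≠ 0 → Y.mkQ s ∈ R ∙ x := by
  obtain ⟨Y, hFY, hY⟩ := zorn_le_nonempty₀ {Y : Submodule R A | s ∉ Y} (fun c hc hchain y hy =>
    ⟨sSup c, fun hmem => by
      obtain ⟨Z, hZ, hsZ⟩ := (Submodule.mem_sSup_of_directed ⟨y, hy⟩ hchain.directedOn).1 hmem
      exact hc hZ hsZ, fun z hz => le_sSup hz⟩) _ hs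
  refine ⟨Y, hFY, hY.1, fun x hx => ?_⟩
  obtain ⟨x, rfl⟩ := Y.mkQ_surjective x
  have hxY : x ∉ Y := fun hmem => hx ((Submodule.Quotient.mk_eq_zero _).2 hmem)
  by_contra hcon
  refine hxY (hY.2 (y := Y ⊔ R ∙ x) (fun hmem => hcon ?_) le_sup_left
    (Submodule.mem_sup_right (Submodule.mem_span_singleton_self x)))
  obtain ⟨y, hy, z, hz, hyz⟩ := Submodule.mem_sup.1 hmem
  obtain ⟨c, rfl⟩ := Submodule.mem_span_singleton.1 hz
  refine Submodule.mem_span_singleton.2 ⟨c, ?_⟩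
  rw [← hyz, map_add, map_smul, (by simpa using hy : Y.mkQ y = 0), zero_add]

variable [IsLocalRing R]

/-- Let `w ∈ W` lie outside `N + R s`. If `s ∈ N + R w`, then `N' = N` will do; otherwise
`N' = N + R (w - s)` does not contain `s`. -/
theorem exists_fg_mem_sup [IsNoetherianRing R] {s : A} {N W : Submodule R A} (hN : N.FG)
    (hsN : s ∉ N) (hW : ¬ W.FG) : ∃ N' : Submodule R A, N ≤ N' ∧ N'.FG ∧ s ∉ N' ∧ s ∈ N' ⊔ W := by
  have hnle : ¬ W ≤ N ⊔ R ∙ s := fun hle => hW <| by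
    have : IsNoetherian R ↥(N ⊔ R ∙ s) :=
      isNoetherian_of_fg_of_noetherian _ (hN.sup (Submodule.fg_span_singleton s))
    exact Submodule.FG.of_le (hN.sup (Submodule.fg_span_singleton s)) hle
  obtain ⟨w, hw, hwn⟩ := SetLike.not_le_iff_exists.1 hnle
  by_cases hs : s ∈ N ⊔ R ∙ w
  · exact ⟨N, le_rfl, hN, hsN,
      sup_le_sup_left ((Submodule.span_singleton_le_iff_mem _ _).2 hw) _ hs⟩
  refine ⟨N ⊔ R ∙ (w - s), le_sup_left, hN.sup (Submodule.fg_span_singleton _), fun hmem => ?_, ?_⟩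
  · obtain ⟨n, hn, y, hy, hny⟩ := Submodule.mem_sup.1 hmem
    obtain ⟨c, rfl⟩ := Submodule.mem_span_singleton.1 hy
    by_cases hc : c ∈ maximalIdeal R
    · have hu : IsUnit (1 + c) := by
        rw [← sub_neg_eq_add]
        exact isUnit_one_sub_self_of_mem_nonunits _ (neg_mem hc)
      refine hs ((Submodule.smul_mem_iff_of_isUnit _ hu).1 ?_)
      have : (1 + c) • s = n + c • w := by
        rw [add_smul, one_smul]; nth_rewrite 1 [← hny]; rw [smul_sub]; abel
      rw [this]
      exact Submodule.add_mem_sup hn (Submodule.smul_mem _ _ (Submodule.mem_span_singleton_self w))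
    · have hu : IsUnit c := by simpa using hc
      refine hwn ((Submodule.smul_mem_iff_of_isUnit _ hu).1 ?_)
      have : c • w = -n + (1 + c) • s := by
        rw [add_smul, one_smul]; nth_rewrite 1 [← hny]; rw [smul_sub]; abel
      rw [this]
      exact Submodule.add_mem_sup (neg_mem hn)
        (Submodule.smul_mem _ _ (Submodule.mem_span_singleton_self s))
  · have := Submodule.add_mem_sup (S := N ⊔ R ∙ (w - s)) (T := W) (Submodule.mem_sup_right
      (neg_mem (Submodule.mem_span_singleton_self _))) hw
    rwa [neg_sub, sub_add_cancel] at this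

/-- If no `rᵉ A` is finitely generated, then `r A` is not small in `A`: an artinian quotient `Q` of
`A` not annihilated by any power of `r` is constructed, and `A` maps onto `rⁿ Q = rⁿ⁺¹ Q ≠ 0`. -/
theorem exists_sup_range_lsmul_eq_top [IsNoetherianRing R] {r : R}
    (h : ∀ e : ℕ, ¬ (LinearMap.range (LinearMap.lsmul R A (r ^ e))).FG) :
    ∃ X : Submodule R A, X ≠ ⊤ ∧ X ⊔ LinearMap.range (LinearMap.lsmul R A r) = ⊤ := by
  obtain ⟨s, hs⟩ : ∃ s : A, s ≠ 0 := by
    by_contra! h0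
    refine h 0 ?_
    have : LinearMap.range (LinearMap.lsmul R A (r ^ 0)) = ⊥ := by
      rw [eq_bot_iff]; exact fun x _ => h0 x
    rw [this]
    exact Submodule.fg_bot
  -- an increasing sequence of finitely generated submodules avoiding `s`
  choose! next hnext using fun (e : ℕ) (N : Submodule R A) (hN : N.FG ∧ s ∉ N) =>
    exists_fg_mem_sup hN.1 hN.2 (h e)
  obtain ⟨N, hN0, hNs⟩ : ∃ N : ℕ → Submodule R A, N 0 = ⊥ ∧ ∀ e, N (e + 1) = next e (N e) :=
    ⟨fun n => Nat.rec ⊥ (fun e N => next e N) n, rfl, fun _ => rfl⟩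
  have hN : ∀ e, (N e).FG ∧ s ∉ N e := by
    intro e
    induction e with
    | zero => exact hN0 ▸ ⟨Submodule.fg_bot, by simpa using hs⟩
    | succ e ih => exact hNs e ▸ ⟨(hnext e _ ih).2.1, (hnext e _ ih).2.2.1⟩
  have hmono : Monotone N := monotone_nat_of_le_succ fun e => (hNs e).symm ▸ (hnext e _ (hN e)).1
  have hsup : s ∉ ⨆ e, N e := by
    rw [Submodule.mem_iSup_of_directed _ hmono.directed_le]
    rintro ⟨e, he⟩
    exact (hN e).2 he
  -- every nonzero submodule of `A ⧸ Y` contains the class of `s`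
  obtain ⟨Y, hNY, hsY, hess⟩ := exists_le_forall_mkQ_mem_span hsup
  have hs' : Y.mkQ s ≠ 0 := fun h0 => hsY (by simpa using h0)
  have : IsArtinian R (A ⧸ Y) := isArtinian_of_mem_span hs' hess
  obtain ⟨n, hn⟩ := IsArtinian.range_smul_pow_stabilizes (A ⧸ Y) r
  have hn1 : ∀ x : A ⧸ Y, ∃ w, r ^ (n + 1) • w = r ^ n • x := fun x => by
    simpa using SetLike.ext_iff.1 (hn (n + 1) (Nat.le_succ n)) (r ^ n • x)
  refine ⟨Y.comap (LinearMap.lsmul R A (r ^ n)), fun htop => hsY ?_, eq_top_iff.2 fun v _ => ?_⟩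
  · have h1 : s ∈ N (n + 1) ⊔ LinearMap.range (LinearMap.lsmul R A (r ^ n)) :=
      (hNs n).symm ▸ (hnext n _ (hN n)).2.2.2
    refine (sup_le ((le_iSup N _).trans hNY) ?_) h1
    rintro _ ⟨v, rfl⟩
    exact htop.ge (Submodule.mem_top (x := v))
  · obtain ⟨w, hw⟩ := hn1 (Y.mkQ v)
    obtain ⟨w, rfl⟩ := Y.mkQ_surjective w
    refine Submodule.mem_sup.2 ⟨v - r • w, ?_, r • w, ⟨w, rfl⟩, by abel⟩
    rw [Submodule.mem_comap, LinearMap.lsmul_apply, smul_sub, smul_smul, ← pow_succ,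
      ← Submodule.Quotient.mk_eq_zero, Submodule.Quotient.mk_sub, sub_eq_zero]
    exact hw.symm

end Artinian

/-! ### The injective hull of the residue field -/

/-- If `ker g ≤ ker f`, then `f` factors through `g`. -/
theorem _root_.Module.Baer.exists_comp_eq {R A B E : Type*} [CommRing R] [AddCommGroup A]
    [Module R A] [AddCommGroup B] [Module R B] [AddCommGroup E] [Module R E]
    (hE : Module.Baer R E) (g : A →ₗ[R] B) (f : A →ₗ[R] E)
    (h : LinearMap.ker g ≤ LinearMap.ker f) : ∃ θ : B →ₗ[R] E, θ ∘ₗ g = f := by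
  obtain ⟨θ, hθ⟩ := hE.extension_property ((LinearMap.ker g).liftQ g le_rfl)
    (LinearMap.ker_eq_bot.1 (Submodule.ker_liftQ_eq_bot _ _ _ le_rfl))
    ((LinearMap.ker g).liftQ f h)
  refine ⟨θ, LinearMap.ext fun a => ?_⟩
  simpa using LinearMap.congr_fun hθ ((LinearMap.ker g).mkQ a)

/-- The character module of `R` is injective. -/
theorem baer_characterModule (R : Type*) [CommRing R] : Module.Baer R (CharacterModule R) := by
  intro I g
  -- `g` is determined by the character `x ↦ g x 1` of `I`, which extends to `R`
  let c : CharacterModule I :=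
    { toFun := fun x => g x 1
      map_zero' := by rw [map_zero]; rfl
      map_add' := fun x y => by rw [map_add]; rfl }
  obtain ⟨c', hc'⟩ := CharacterModule.dual_surjective_of_injective (Submodule.subtype I)
    (Submodule.subtype_injective I) c
  refine ⟨LinearMap.toSpanSingleton R _ c', fun x hx => CharacterModule.ext _ fun a => ?_⟩
  have h1 := DFunLike.congr_fun hc' (a • (⟨x, hx⟩ : I))
  have h2 : c (a • (⟨x, hx⟩ : I)) = g ⟨x, hx⟩ a := by
    change g (a • (⟨x, hx⟩ : I)) 1 = _
    rw [map_smul, CharacterModule.smul_apply, smul_eq_mul, mul_one]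
  rw [← h2, ← h1, CharacterModule.dual_apply, LinearMap.toSpanSingleton_apply,
    CharacterModule.smul_apply]
  change c' _ = c' _
  congr 1
  simp [mul_comm]

/-- `E` is an injective hull of the residue field of the local ring `R`, embedded in `E` as the
submodule `R s`: the module `E` is injective, and each of its nonzero submodules contains
`s ≠ 0`. -/
structure IsResidueHull (R E : Type*) [CommRing R] [AddCommGroup E] [Module R E] (s : E) :
    Prop where
  baer : Module.Baer R E
  ne_zero : s ≠ 0
  mem_span : ∀ x : E, x ≠ 0 → s ∈ R ∙ x

/-- In the injective module of characters of `R`, a maximal essential extension of a copy of the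
residue field is a direct summand. -/
theorem exists_isResidueHull (R : Type*) [CommRing R] [IsLocalRing R] :
    ∃ (E : Submodule R (CharacterModule R)) (s : E), IsResidueHull R E s := by
  obtain ⟨c, hc⟩ := CharacterModule.exists_character_apply_ne_zero_of_ne_zero
    (A := R ⧸ maximalIdeal R) (a := 1) one_ne_zero
  obtain ⟨s, hs0, hms⟩ : ∃ s : CharacterModule R, s ≠ 0 ∧ ∀ a ∈ maximalIdeal R, a • s = 0 := by
    refine ⟨CharacterModule.dual (maximalIdeal R).mkQ c, fun h0 => hc ?_, fun a ha => ?_⟩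
    · exact DFunLike.congr_fun h0 (1 : R)
    · refine CharacterModule.ext _ fun x => ?_
      rw [CharacterModule.smul_apply, CharacterModule.dual_apply]
      change c ((maximalIdeal R).mkQ (a • x)) = 0
      have h0 : (maximalIdeal R).mkQ (a • x) = 0 :=
        (Submodule.Quotient.mk_eq_zero _).2 (Ideal.mul_mem_right x _ ha)
      rw [h0, map_zero]
  obtain ⟨E, hsE, hE⟩ := zorn_le_nonempty₀
    {A : Submodule R (CharacterModule R) | s ∈ A ∧ ∀ x ∈ A, x ≠ 0 → s ∈ R ∙ x}
    (fun C hC hchain A hA => ⟨sSup C, ⟨le_sSup hA (hC hA).1, fun x hx hx0 => by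
      obtain ⟨B, hB, hxB⟩ := (Submodule.mem_sSup_of_directed ⟨A, hA⟩ hchain.directedOn).1 hx
      exact (hC hB).2 x hxB hx0⟩, fun B hB => le_sSup hB⟩) (R ∙ s)
    ⟨Submodule.mem_span_singleton_self s, fun x hx hx0 => by
      obtain ⟨a, rfl⟩ := Submodule.mem_span_singleton.1 hx
      by_cases ha : a ∈ maximalIdeal R
      · exact absurd (hms a ha) hx0
      · obtain ⟨u, rfl⟩ : IsUnit a := by simpa using ha
        exact Submodule.mem_span_singleton.2 ⟨(u⁻¹ : Rˣ), by simp [smul_smul]⟩⟩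
  obtain ⟨hs, hess⟩ := hE.1
  -- the retraction of the character module onto `E` is constructed on its quotient by a submodule
  -- which is maximal without `s`
  obtain ⟨X, -, hsX, hquot⟩ := exists_le_forall_mkQ_mem_span 
    (A := CharacterModule R) (R := R) (F := ⊥) (s := s) (by simpa using hs0)
  obtain ⟨ψ, hψ⟩ := (baer_characterModule R).exists_comp_eq (X.mkQ ∘ₗ E.subtype) E.subtype (by
    intro x hx
    by_contra hx0
    have hxX : (x : CharacterModule R) ∈ X := by simpa using hx
    exact hsX ((Submodule.span_singleton_le_iff_mem _ _).2 hxX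
      (hess x x.2 fun h0 => hx0 (by simpa using h0))))
  have hψE : ∀ x ∈ E, ψ (X.mkQ x) = x := fun x hx => LinearMap.congr_fun hψ ⟨x, hx⟩
  have hrange : LinearMap.range ψ ≤ E := by
    refine hE.2 ⟨⟨X.mkQ s, hψE s hs⟩, ?_⟩ fun x hx => ⟨X.mkQ x, hψE x hx⟩
    rintro _ ⟨x, rfl⟩ hx
    obtain ⟨a, ha⟩ := Submodule.mem_span_singleton.1 (hquot x fun h0 => hx (by rw [h0, map_zero]))
    exact Submodule.mem_span_singleton.2 ⟨a, by rw [← map_smul, ha, hψE s hs]⟩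
  refine ⟨E, ⟨s, hs⟩, fun I g => ?_, fun h0 => hs0 (congrArg Subtype.val h0), fun x hx => ?_⟩
  · obtain ⟨g', hg'⟩ := baer_characterModule R I (E.subtype ∘ₗ g)
    refine ⟨(ψ.codRestrict E fun x => hrange ⟨x, rfl⟩) ∘ₗ X.mkQ ∘ₗ g', fun x hx => Subtype.ext ?_⟩
    change ψ (X.mkQ (g' x)) = g ⟨x, hx⟩
    rw [hg' x hx]
    exact hψE _ (g ⟨x, hx⟩).2
  · obtain ⟨a, ha⟩ := Submodule.mem_span_singleton.1
      (hess x x.2 fun h0 => hx (Subtype.ext h0))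
    exact Submodule.mem_span_singleton.2 ⟨a, Subtype.ext ha⟩

namespace IsResidueHull

variable {R E : Type*} [CommRing R] [AddCommGroup E] [Module R E] {s : E}

/-- `E` is a cogenerator. -/
theorem exists_apply_ne_zero [IsLocalRing R] (hE : IsResidueHull R E s) {A : Type*}
    [AddCommGroup A] [Module R A] {F : Submodule R A} {x : A} (hx : x ∉ F) :
    ∃ f : A →ₗ[R] E, F ≤ LinearMap.ker f ∧ f x ≠ 0 := by
  obtain ⟨θ, hθ⟩ := hE.baer.exists_comp_eq (LinearMap.toSpanSingleton R (A ⧸ F) (F.mkQ x))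
    (LinearMap.toSpanSingleton R E s) (by
      intro a ha
      by_cases ham : a ∈ maximalIdeal R
      · exact smul_eq_zero_of_mem_span hE.mem_span ham
      · have hu : IsUnit a := by simpa using ham
        exact absurd (by simpa using hu.smul_eq_zero.1 ha) hx)
  refine ⟨θ ∘ₗ F.mkQ, fun y hy => ?_, fun h0 => hE.ne_zero ?_⟩
  · have : F.mkQ y = 0 := by simpa using hy
    rw [LinearMap.mem_ker, LinearMap.comp_apply, this, map_zero]
  · rw [← h0]
    simpa using (LinearMap.congr_fun hθ 1).symm

/-! ### Endomorphisms of the hull -/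

theorem length_hom_le_of_isSimpleModule (hE : IsResidueHull R E s) {T : Type*} [AddCommGroup T]
    [Module R T] [IsSimpleModule R T] : Module.length R (T →ₗ[R] E) ≤ 1 := by
  have := IsSimpleModule.nontrivial R T
  obtain ⟨t, ht⟩ := exists_ne (0 : T)
  have hsurj := IsSimpleModule.toSpanSingleton_surjective R ht
  have := isSimpleModule_span_singleton hE.ne_zero hE.mem_span
  rw [← Module.length_eq_one R (R ∙ s)]
  refine Module.length_le_of_injective
    ((LinearMap.applyₗ t : (T →ₗ[R] E) →ₗ[R] E).codRestrict (R ∙ s) fun φ => ?_)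
    fun φ φ' h => LinearMap.ext fun y => ?_
  · rcases eq_or_ne (φ t) 0 with h0 | h0
    · exact (show (LinearMap.applyₗ t : (T →ₗ[R] E) →ₗ[R] E) φ = 0 from h0) ▸ zero_mem _
    obtain ⟨a, ha⟩ := Submodule.mem_span_singleton.1 (hE.mem_span _ h0)
    have hat : a • t ≠ 0 := fun h0 => hE.ne_zero (by rw [← ha, ← map_smul, h0, map_zero])
    obtain ⟨b, hb⟩ := IsSimpleModule.toSpanSingleton_surjective R hat t
    refine Submodule.mem_span_singleton.2 ⟨b, ?_⟩
    rw [← ha, ← map_smul, ← map_smul]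
    exact congrArg φ hb
  · obtain ⟨a, rfl⟩ := hsurj y
    have h1 : φ t = φ' t := congrArg Subtype.val h
    simp [h1]

theorem length_hom_le (hE : IsResidueHull R E s) {L : Type*} [AddCommGroup L] [Module R L]
    (hL : IsFiniteLength R L) : Module.length R (L →ₗ[R] E) ≤ Module.length R L := by
  induction hL with
  | @of_subsingleton L _ _ _ =>
    have : Subsingleton (L →ₗ[R] E) := ⟨fun f g => LinearMap.ext fun x => by
      rw [Subsingleton.elim x 0, map_zero, map_zero]⟩
    rw [Module.length_eq_zero]
    exact zero_le
  | @of_simple_quotient L _ _ N _ _ ih =>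
    let ρ : (L →ₗ[R] E) →ₗ[R] (N →ₗ[R] E) := LinearMap.lcomp R E N.subtype
    let κ : LinearMap.ker ρ →ₗ[R] (L ⧸ N →ₗ[R] E) :=
      { toFun := fun φ => N.liftQ φ.1 fun x hx => LinearMap.congr_fun φ.2 ⟨x, hx⟩
        map_add' := fun φ φ' => by ext; rfl
        map_smul' := fun a φ => by ext; rfl }
    have hκ : Function.Injective κ := fun φ φ' h => Subtype.ext (LinearMap.ext fun x => by
      exact LinearMap.congr_fun h (N.mkQ x))
    rw [Module.length_eq_add_of_exact (LinearMap.ker ρ).subtype ρ.rangeRestrict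
      (Submodule.subtype_injective _) ρ.surjective_rangeRestrict
      (by intro x; simp [Subtype.ext_iff]),
      Module.length_eq_add_of_exact N.subtype N.mkQ (Submodule.subtype_injective _)
      N.mkQ_surjective (LinearMap.exact_subtype_mkQ N), add_comm]
    refine add_le_add ((Module.length_le_of_injective (LinearMap.range ρ).subtype
      (Submodule.subtype_injective _)).trans ih) ?_
    rw [Module.length_eq_one R (L ⧸ N)]
    exact (Module.length_le_of_injective κ hκ).trans hE.length_hom_le_of_isSimpleModule

variable [IsLocalRing R] [IsNoetherianRing R]

theorem isArtinian (hE : IsResidueHull R E s) : IsArtinian R E :=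
  isArtinian_of_mem_span hE.ne_zero hE.mem_span

theorem exists_mem_torsionBySet (hE : IsResidueHull R E s) (x : E) :
    ∃ n : ℕ, x ∈ Submodule.torsionBySet R E (maximalIdeal R ^ n : Ideal R) :=
  SupplementedModule.exists_mem_torsionBySet hE.ne_zero hE.mem_span x

theorem isNoetherian_torsionBySet (hE : IsResidueHull R E s) (n : ℕ) :
    IsNoetherian R (Submodule.torsionBySet R E (maximalIdeal R ^ n : Ideal R)) := by
  have := hE.isArtinian
  refine isNoetherian_of_isArtinian_of_pow_smul (n := n) fun c hc a => Subtype.ext ?_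
  exact (Submodule.mem_torsionBySet_iff _ _).1 a.2 ⟨c, hc⟩

/-- On `E[𝔪ⁿ]`, an endomorphism of `E` is multiplication by a ring element: `R ⧸ 𝔪ⁿ` embeds in
`Hom(E[𝔪ⁿ], E)`, and the two have the same length. -/
theorem exists_eq_smul (hE : IsResidueHull R E s) (φ : E →ₗ[R] E) (n : ℕ) :
    ∃ a : R, ∀ x ∈ Submodule.torsionBySet R E (maximalIdeal R ^ n : Ideal R), φ x = a • x := by
  set I : Ideal R := maximalIdeal R ^ n
  set L := Submodule.torsionBySet R E (I : Set R)
  have := hE.isArtinian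
  have := hE.isNoetherian_torsionBySet n
  have hLfin : IsFiniteLength R L :=
    isFiniteLength_iff_isNoetherian_isArtinian.2 ⟨this, inferInstance⟩
  let β : R ⧸ I →ₗ[R] (L →ₗ[R] E) := I.liftQ (LinearMap.toSpanSingleton R _ L.subtype)
    fun a ha => LinearMap.ext fun x => (Submodule.mem_torsionBySet_iff _ _).1 x.2 ⟨a, ha⟩
  have hβ : Function.Injective β := by
    refine LinearMap.ker_eq_bot.1 (Submodule.ker_liftQ_eq_bot _ _ _ fun a ha => ?_)
    by_contra haI
    obtain ⟨f, hf, hfa⟩ := hE.exists_apply_ne_zero (A := R) haI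
    refine hfa ?_
    have h1 : f 1 ∈ L := by
      rw [Submodule.mem_torsionBySet_iff]
      intro c
      rw [← map_smul, smul_eq_mul, mul_one]
      exact hf c.2
    have h2 := LinearMap.congr_fun ha ⟨f 1, h1⟩
    have h3 : a • f 1 = 0 := h2
    rwa [← map_smul, smul_eq_mul, mul_one] at h3
  have hle := hE.length_hom_le hLfin
  have hH : Module.length R (L →ₗ[R] E) ≠ ⊤ :=
    ne_top_of_le_ne_top (Module.length_ne_top_iff.2 hLfin) hle
  have hRI : IsFiniteLength R (R ⧸ I) := Module.length_ne_top_iff.1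
    (ne_top_of_le_ne_top hH (Module.length_le_of_injective β hβ))
  -- `E[I]` embeds in `Hom(R ⧸ I, E)`, hence is at most as long as `R ⧸ I`
  let γ : L →ₗ[R] (R ⧸ I →ₗ[R] E) :=
    { toFun := fun x => I.liftQ (LinearMap.toSpanSingleton R E x) fun a ha =>
        (Submodule.mem_torsionBySet_iff _ _).1 x.2 ⟨a, ha⟩
      map_add' := fun x y => LinearMap.ext fun q => by
        obtain ⟨c, rfl⟩ := I.mkQ_surjective q
        exact smul_add c (x : E) y
      map_smul' := fun a x => LinearMap.ext fun q => by
        obtain ⟨c, rfl⟩ := I.mkQ_surjective q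
        exact smul_comm c a (x : E) }
  have hγ : Function.Injective γ := fun x y h => Subtype.ext (by
    have h1 : (1 : R) • (x : E) = (1 : R) • (y : E) := LinearMap.congr_fun h (I.mkQ 1)
    rwa [one_smul, one_smul] at h1)
  have hlen : Module.length R (L →ₗ[R] E) ≤ Module.length R (R ⧸ I) :=
    hle.trans ((Module.length_le_of_injective γ hγ).trans (hE.length_hom_le hRI))
  have hadd := Module.length_eq_add_of_exact β (LinearMap.range β).mkQ hβ
    (Submodule.mkQ_surjective _) (LinearMap.exact_map_mkQ_range β)
  have hzero : Module.length R ((L →ₗ[R] E) ⧸ LinearMap.range β) = 0 := by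
    rw [hadd] at hlen
    have := Module.length_ne_top_iff.2 hRI
    generalize Module.length R (R ⧸ I) = a at *
    generalize Module.length R ((L →ₗ[R] E) ⧸ LinearMap.range β) = b at *
    lift a to ℕ using this
    induction b with
    | top => simp at hlen
    | coe b => norm_cast at *; omega
  rw [Module.length_eq_zero_iff, Submodule.Quotient.subsingleton_iff] at hzero
  obtain ⟨q, hq⟩ := hzero.ge (Submodule.mem_top (x := φ ∘ₗ L.subtype))
  obtain ⟨a, rfl⟩ := I.mkQ_surjective q
  exact ⟨a, fun x hx => (LinearMap.congr_fun hq ⟨x, hx⟩).symm⟩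

/-- The endomorphism ring of `E` is commutative. -/
theorem apply_comm (hE : IsResidueHull R E s) (φ ψ : E →ₗ[R] E) (x : E) :
    φ (ψ x) = ψ (φ x) := by
  obtain ⟨n, hn⟩ := hE.exists_mem_torsionBySet x
  obtain ⟨a, ha⟩ := hE.exists_eq_smul φ n
  have hψ : ψ x ∈ Submodule.torsionBySet R E (maximalIdeal R ^ n : Ideal R) := by
    rw [Submodule.mem_torsionBySet_iff] at hn ⊢
    intro c
    rw [← map_smul, hn, map_zero]
  rw [ha x hn, ha _ hψ, map_smul]

end IsResidueHull

/-! ### Submodules with artinian quotient -/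

section

variable {R N : Type*} [CommRing R] [AddCommGroup N] [Module R N]

theorem isArtinian_quotient_of_le {X Y : Submodule R N} (h : X ≤ Y) (hX : IsArtinian R (N ⧸ X)) :
    IsArtinian R (N ⧸ Y) :=
  isArtinian_of_surjective _ (Submodule.factor h) (Submodule.factor_surjective h)

theorem isArtinian_quotient_ker {B : Type*} [AddCommGroup B] [Module R B] [IsArtinian R B]
    (f : N →ₗ[R] B) : IsArtinian R (N ⧸ LinearMap.ker f) :=
  isArtinian_of_injective ((LinearMap.ker f).liftQ f le_rfl)
    (LinearMap.ker_eq_bot.1 (Submodule.ker_liftQ_eq_bot _ _ _ le_rfl))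

theorem isArtinian_quotient_inf {X Y : Submodule R N} (hX : IsArtinian R (N ⧸ X))
    (hY : IsArtinian R (N ⧸ Y)) : IsArtinian R (N ⧸ (X ⊓ Y)) := by
  have := isArtinian_quotient_ker (X.mkQ.prod Y.mkQ)
  rwa [LinearMap.ker_prod, Submodule.ker_mkQ, Submodule.ker_mkQ] at this

theorem exists_finset_iInf_le {ι : Type*} [IsArtinian R N] (K : ι → Submodule R N) :
    ∃ t : Finset ι, ∀ i, ⨅ j ∈ t, K j ≤ K i := by
  classical
  obtain ⟨_, ⟨t, rfl⟩, ht⟩ := IsArtinian.set_has_minimal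
    (Set.range fun t : Finset ι => ⨅ j ∈ t, K j) ⟨_, ∅, rfl⟩
  refine ⟨t, fun i => ?_⟩
  by_contra hi
  refine ht _ ⟨insert i t, rfl⟩ ?_
  beta_reduce
  rw [Finset.iInf_insert]
  exact lt_of_le_of_ne inf_le_right fun heq => hi (heq ▸ inf_le_left)

/-- A nonzero submodule of an artinian module meets the socle. -/
theorem exists_smul_ne_zero_of_isArtinian [IsLocalRing R] [IsArtinian R N] {x : N} (hx : x ≠ 0) :
    ∃ a : R, a • x ≠ 0 ∧ ∀ c ∈ maximalIdeal R, c • a • x = 0 := by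
  obtain ⟨_, ⟨a, ha, rfl⟩, hmin⟩ := IsArtinian.set_has_minimal
    {S : Submodule R N | ∃ a : R, a • x ≠ 0 ∧ S = R ∙ (a • x)} ⟨_, 1, by simpa using hx, rfl⟩
  refine ⟨a, ha, fun c hc => ?_⟩
  by_contra h0
  refine hmin _ ⟨c * a, by rwa [mul_smul], rfl⟩ (lt_of_le_of_ne ?_ fun heq => ?_)
  · rw [Submodule.span_singleton_le_iff_mem, mul_smul]
    exact Submodule.smul_mem _ _ (Submodule.mem_span_singleton_self _)
  · obtain ⟨b, hb⟩ := Submodule.mem_span_singleton.1 (heq.ge (Submodule.mem_span_singleton_self _))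
    have hu : IsUnit (1 - b * c) :=
      isUnit_one_sub_self_of_mem_nonunits _ (Ideal.mul_mem_left _ b hc)
    refine ha (hu.smul_eq_zero.1 ?_)
    rw [sub_smul, one_smul, sub_eq_zero, mul_smul, ← mul_smul c a, hb]

end

/-! ### Stable values of homomorphisms into an artinian module -/

section StableValues

variable (R N E : Type*) [CommRing R] [AddCommGroup N] [Module R N] [AddCommGroup E] [Module R E]
  [IsArtinian R E]

/-- The elements `z` of `E` which remain values `f x` of homomorphisms `f : N → E` when `f` is
required to vanish on an arbitrary finitely generated submodule, and `x` to lie in an arbitrary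
submodule with artinian quotient. -/
def stableValues : Submodule R E where
  carrier := {z | ∀ F X : Submodule R N, F.FG → IsArtinian R (N ⧸ X) →
    ∃ f : N →ₗ[R] E, F ≤ LinearMap.ker f ∧ ∃ x ∈ X, f x = z}
  zero_mem' := fun _ X _ _ => ⟨0, by simp, 0, X.zero_mem, by simp⟩
  smul_mem' := by
    intro c z hz F X hF hX
    obtain ⟨f, hf, x, hx, rfl⟩ := hz F X hF hX
    exact ⟨f, hf, c • x, X.smul_mem c hx, map_smul _ _ _⟩
  add_mem' := by
    intro z z' hz hz' F X hF hX
    obtain ⟨f, hf, x, hx, rfl⟩ := hz F X hF hX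
    obtain ⟨f', hf', x', hx', rfl⟩ := hz' (F ⊔ R ∙ x) (X ⊓ LinearMap.ker f)
      (hF.sup (Submodule.fg_span_singleton x)) (isArtinian_quotient_inf hX
        (isArtinian_quotient_ker f))
    have h1 : f x' = 0 := hx'.2
    have h2 : f' x = 0 := hf' (Submodule.mem_sup_right (Submodule.mem_span_singleton_self x))
    refine ⟨f + f', fun y hy => ?_, x + x', X.add_mem hx hx'.1, ?_⟩
    · have h3 : f y = 0 := hf hy
      have h4 : f' y = 0 := hf' (Submodule.mem_sup_left hy)
      rw [LinearMap.mem_ker, LinearMap.add_apply, h3, h4, add_zero]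
    · rw [LinearMap.add_apply, map_add, map_add, h1, h2, add_zero, zero_add]

variable {R N E}

/-- Stable values are even realised simultaneously, for all elements of a finitely generated
submodule. -/
theorem exists_map_eq_of_fg {F X : Submodule R N} (hF : F.FG) (hX : IsArtinian R (N ⧸ X))
    {Y : Submodule R E} (hY : Y.FG) (hYZ : Y ≤ stableValues R N E) :
    ∃ (f : N →ₗ[R] E) (P : Submodule R N), F ≤ LinearMap.ker f ∧ P.FG ∧ P ≤ X ∧ P.map f = Y := by
  induction Y, hY using Submodule.fg_induction generalizing F X with
  | singleton z =>
    obtain ⟨f, hf, x, hx, rfl⟩ := hYZ (Submodule.mem_span_singleton_self z) F X hF hX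
    exact ⟨f, R ∙ x, hf, Submodule.fg_span_singleton x,
      (Submodule.span_singleton_le_iff_mem _ _).2 hx, by
        rw [Submodule.map_span, Set.image_singleton]⟩
  | sup Y₁ Y₂ _ _ ih₁ ih₂ =>
    obtain ⟨f, P, hf, hP, hPX, rfl⟩ := ih₁ hF hX (le_sup_left.trans hYZ)
    obtain ⟨f', P', hf', hP', hPX', rfl⟩ := ih₂ (hF.sup hP)
      (isArtinian_quotient_inf hX (isArtinian_quotient_ker f)) (le_sup_right.trans hYZ)
    refine ⟨f + f', P ⊔ P', fun y hy => ?_, hP.sup hP',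
      sup_le hPX (hPX'.trans inf_le_left), ?_⟩
    · have h3 : f y = 0 := hf hy
      have h4 : f' y = 0 := hf' (Submodule.mem_sup_left hy)
      rw [LinearMap.mem_ker, LinearMap.add_apply, h3, h4, add_zero]
    · rw [Submodule.map_sup]
      congr 1
      · refine SetLike.coe_injective (Set.image_congr fun y hy => ?_)
        have h4 : f' y = 0 := hf' (Submodule.mem_sup_right hy)
        rw [LinearMap.add_apply, h4, add_zero]
      · refine SetLike.coe_injective (Set.image_congr fun y hy => ?_)
        have h3 : f y = 0 := (hPX' hy).2
        rw [LinearMap.add_apply, h3, zero_add]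

/-- All values become stable once `f` is required to vanish on a suitable finitely generated
submodule and `x` to lie in a suitable submodule with artinian quotient. Otherwise unstable values
span a nonzero subspace of the socle of `E ⧸ stableValues R N E`, the same one for all large
conditions; as it has finite dimension, finitely many values obtained one after the other span it,
so that all its elements come from stable values. -/
theorem exists_apply_mem_stableValues [IsLocalRing R] [IsNoetherianRing R] :
    ∃ F X : Submodule R N, F.FG ∧ IsArtinian R (N ⧸ X) ∧
      ∀ f : N →ₗ[R] E, F ≤ LinearMap.ker f → ∀ x ∈ X, f x ∈ stableValues R N E := by
  by_contra! hcon
  set Z := stableValues R N E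
  let T : Submodule R (E ⧸ Z) := Submodule.torsionBySet R (E ⧸ Z) (maximalIdeal R : Set R)
  have hT : IsNoetherian R T := by
    refine isNoetherian_of_isArtinian_of_pow_smul (n := 1) fun c hc a => Subtype.ext ?_
    rw [pow_one] at hc
    exact (Submodule.mem_torsionBySet_iff _ _).1 a.2 ⟨c, hc⟩
  let S : Submodule R N → Submodule R N → Submodule R (E ⧸ Z) := fun F X =>
    Submodule.span R {q | q ∈ T ∧ ∃ f : N →ₗ[R] E, F ≤ LinearMap.ker f ∧ ∃ x ∈ X, Z.mkQ (f x) = q}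
  have hSmono : ∀ {F F' X X' : Submodule R N}, F ≤ F' → X' ≤ X → S F' X' ≤ S F X := by
    intro F F' X X' hFF hXX
    refine Submodule.span_mono ?_
    rintro q ⟨hq, f, hf, x, hx, hfx⟩
    exact ⟨hq, f, hFF.trans hf, x, hXX hx, hfx⟩
  obtain ⟨_, ⟨F₁, X₁, hF₁, hX₁, rfl⟩, hmin⟩ := IsArtinian.set_has_minimal
    {S' : Submodule R (E ⧸ Z) | ∃ F X : Submodule R N, F.FG ∧ IsArtinian R (N ⧸ X) ∧ S' = S F X}
    ⟨_, ⊥, ⊤, Submodule.fg_bot, inferInstance, rfl⟩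
  have hSeq : ∀ {F X : Submodule R N}, F.FG → IsArtinian R (N ⧸ X) → F₁ ≤ F → X ≤ X₁ →
      S F₁ X₁ ≤ S F X := by
    intro F X hF hX hle hle'
    by_contra hnot
    exact hmin _ ⟨F, X, hF, hX, rfl⟩ (lt_of_le_not_ge (hSmono hle hle') hnot)
  have key : ∀ y : E, Z.mkQ y ∈ S F₁ X₁ → y ∈ Z := by
    intro y hy F X hF hX
    -- finitely many socle elements obtained one after the other, as many as possible
    obtain ⟨W, ⟨f, P, hf, hP, hPX, hfP⟩, hWmax⟩ := set_has_maximal_iff_noetherian.2 hT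
      {W : Submodule R T | ∃ (f : N →ₗ[R] E) (P : Submodule R N), F ⊔ F₁ ≤ LinearMap.ker f ∧ P.FG ∧
        P ≤ X ⊓ X₁ ∧ P.map (Z.mkQ ∘ₗ f) = W.map T.subtype}
      ⟨⊥, 0, ⊥, by simp, Submodule.fg_bot, bot_le, by simp⟩
    have hF' : (F ⊔ F₁ ⊔ P).FG := (hF.sup hF₁).sup hP
    have hX' : IsArtinian R (N ⧸ (X ⊓ X₁ ⊓ LinearMap.ker f)) :=
      isArtinian_quotient_inf (isArtinian_quotient_inf hX hX₁) (isArtinian_quotient_ker f)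
    have hle : S F₁ X₁ ≤ W.map T.subtype := by
      refine (hSeq hF' hX' (le_sup_right.trans le_sup_left)
        (inf_le_left.trans inf_le_right)).trans (Submodule.span_le.2 ?_)
      rintro q ⟨hq, f', hf', x', hx', hfx'⟩
      have h1 : f x' = 0 := hx'.2
      have hW' : W ⊔ R ∙ (⟨q, hq⟩ : T) = W := by
        by_contra hne
        refine hWmax _ ⟨f + f', P ⊔ R ∙ x', fun y hy => ?_, hP.sup (Submodule.fg_span_singleton _),
          sup_le hPX ((Submodule.span_singleton_le_iff_mem _ _).2 hx'.1), ?_⟩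
          (lt_of_le_of_ne le_sup_left (Ne.symm hne))
        · have h3 : f y = 0 := hf hy
          have h4 : f' y = 0 := hf' (Submodule.mem_sup_left hy)
          rw [LinearMap.mem_ker, LinearMap.add_apply, h3, h4, add_zero]
        · rw [Submodule.map_sup, Submodule.map_sup, ← hfP]
          congr 1
          · refine SetLike.coe_injective (Set.image_congr fun y hy => ?_)
            have h4 : f' y = 0 := hf' (Submodule.mem_sup_right hy)
            rw [LinearMap.comp_apply, LinearMap.add_apply, h4, add_zero, LinearMap.comp_apply]
          · rw [Submodule.map_span, Set.image_singleton, Submodule.map_span, Set.image_singleton,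
              LinearMap.comp_apply, LinearMap.add_apply, h1, zero_add, hfx']
            rfl
      exact ⟨⟨q, hq⟩, hW'.le (Submodule.mem_sup_right (Submodule.mem_span_singleton_self _)), rfl⟩
    obtain ⟨p, hp, hpy⟩ := hfP.ge (hle hy)
    have hyp : y - f p ∈ Z := by
      rw [← Submodule.Quotient.mk_eq_zero, Submodule.Quotient.mk_sub, sub_eq_zero]
      exact hpy.symm
    obtain ⟨f', hf', x', hx', hfx'⟩ := hyp _ _ hF' hX'
    have h1 : f x' = 0 := hx'.2
    have h2 : f' p = 0 := hf' (Submodule.mem_sup_right hp)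
    refine ⟨f + f', fun y hy => ?_, p + x', X.add_mem (hPX hp).1 hx'.1.1, ?_⟩
    · have h3 : f y = 0 := hf (Submodule.mem_sup_left hy)
      have h4 : f' y = 0 := hf' (Submodule.mem_sup_left (Submodule.mem_sup_left hy))
      rw [LinearMap.mem_ker, LinearMap.add_apply, h3, h4, add_zero]
    · rw [LinearMap.add_apply, map_add, map_add, h1, h2, hfx']
      abel
  obtain ⟨f, hf, x, hx, hfx⟩ := hcon F₁ X₁ hF₁ hX₁
  obtain ⟨a, ha, hma⟩ := exists_smul_ne_zero_of_isArtinian (R := R) (x := Z.mkQ (f x))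
    (fun h0 => hfx (by simpa using h0))
  refine ha ?_
  rw [← map_smul, ← map_smul]
  refine (Submodule.Quotient.mk_eq_zero _).2 (key _ (Submodule.subset_span
    ⟨?_, f, hf, a • x, X₁.smul_mem a hx, rfl⟩))
  rw [Submodule.mem_torsionBySet_iff]
  intro c
  rw [map_smul, map_smul]
  exact hma c c.2

end StableValues

/-! ### Correcting homomorphisms so that all their values are stable -/

section

variable {R E N : Type*} [CommRing R] [IsLocalRing R] [IsNoetherianRing R] [AddCommGroup E]
  [Module R E] {s : E} [AddCommGroup N] [Module R N]

/-- A submodule of `E` is a finite intersection of kernels of endomorphisms of `E`. -/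
theorem IsResidueHull.exists_finset_forall_mem (hE : IsResidueHull R E s) (Z : Submodule R E) :
    ∃ t : Finset (E →ₗ[R] E), (∀ l ∈ t, Z ≤ LinearMap.ker l) ∧ ∀ y, (∀ l ∈ t, l y = 0) → y ∈ Z := by
  classical
  have := hE.isArtinian
  obtain ⟨t, ht⟩ := exists_finset_iInf_le
    (fun l : {l : E →ₗ[R] E // Z ≤ LinearMap.ker l} => LinearMap.ker l.1)
  refine ⟨t.image Subtype.val, ?_, fun y hy => ?_⟩
  · intro l hl
    obtain ⟨l, -, rfl⟩ := Finset.mem_image.1 hl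
    exact l.2
  · by_contra hyZ
    obtain ⟨l, hl, hly⟩ := hE.exists_apply_ne_zero hyZ
    refine hly (ht ⟨l, hl⟩ ?_)
    simp only [Submodule.mem_iInf]
    exact fun j hj => hy _ (Finset.mem_image_of_mem _ hj)

/-- If all `f : N → E` vanishing on `F₀` have values in `Z` on a submodule with artinian quotient,
then, on a smaller such submodule, each of them agrees with a homomorphism with all values in `Z`.
Indeed, for `Z` the intersection of the kernels of `l₁, …, lₘ`, the maps `(lᵢ ∘ f)ᵢ` factor through
an artinian module, where finitely many of them generate all of them over the endomorphism ring of
`E`; as endomorphisms of `E` commute with the `lᵢ`, a combination of the corresponding `f` can be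
subtracted. -/
theorem IsResidueHull.exists_forall_apply_mem (hE : IsResidueHull R E s) {F₀ X₀ : Submodule R N}
    (hX₀ : IsArtinian R (N ⧸ X₀)) {Z : Submodule R E}
    (h : ∀ f : N →ₗ[R] E, F₀ ≤ LinearMap.ker f → ∀ x ∈ X₀, f x ∈ Z) :
    ∃ X₁ ≤ X₀, IsArtinian R (N ⧸ X₁) ∧ ∀ f : N →ₗ[R] E, F₀ ≤ LinearMap.ker f →
      ∃ f' : N →ₗ[R] E, (∀ n, f' n ∈ Z) ∧ F₀ ≤ LinearMap.ker f' ∧ ∀ x ∈ X₁, f' x = f x := by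
  classical
  have := hE.isArtinian
  obtain ⟨t, htZ, ht⟩ := hE.exists_finset_forall_mem Z
  let H := {f : N →ₗ[R] E // F₀ ≤ LinearMap.ker f}
  have hlf : ∀ (f : H) (l : t), X₀ ≤ LinearMap.ker (l.1 ∘ₗ f.1) := fun f l x hx =>
    htZ l.1 l.2 (h f.1 f.2 x hx)
  let ψ : H → ((t → N ⧸ X₀) →ₗ[R] E) := fun f =>
    ∑ l : t, X₀.liftQ (l.1 ∘ₗ f.1) (hlf f l) ∘ₗ LinearMap.proj l
  have hψ : ∀ (f : H) (l : t) (n : N), ψ f (Pi.single l (X₀.mkQ n)) = l.1 (f.1 n) := by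
    intro f l n
    simp only [ψ, LinearMap.sum_apply, LinearMap.comp_apply, LinearMap.proj_apply]
    rw [Finset.sum_eq_single l]
    · rw [Pi.single_eq_same]
      rfl
    · intro j _ hj
      rw [Pi.single_eq_of_ne hj, map_zero]
    · exact fun hl => absurd (Finset.mem_univ _) hl
  obtain ⟨u, hu⟩ := exists_finset_iInf_le (fun f : H => LinearMap.ker (ψ f))
  refine ⟨X₀ ⊓ LinearMap.ker (LinearMap.pi fun j : u => j.1.1), inf_le_left,
    isArtinian_quotient_inf hX₀ (isArtinian_quotient_ker _), fun f hf => ?_⟩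
  obtain ⟨θ, hθ⟩ := hE.baer.exists_comp_eq (LinearMap.pi fun j : u => ψ j.1) (ψ ⟨f, hf⟩) (by
    refine le_trans (fun x hx => ?_) (hu ⟨f, hf⟩)
    simp only [Submodule.mem_iInf]
    exact fun j hj => congrFun hx ⟨j, hj⟩)
  have hsum : ∀ w : u → E, θ w = ∑ j, θ (Pi.single j (w j)) := fun w => by
    rw [← map_sum, Finset.univ_sum_single]
  refine ⟨f - ∑ j : u, (θ ∘ₗ LinearMap.single R (fun _ => E) j) ∘ₗ j.1.1,
    fun n => ht _ fun l hl => ?_, fun x hx => ?_, fun x hx => ?_⟩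
  · have h1 := LinearMap.congr_fun hθ (Pi.single ⟨l, hl⟩ (X₀.mkQ n))
    rw [LinearMap.comp_apply, hψ, hsum] at h1
    simp only [LinearMap.pi_apply, hψ] at h1
    rw [LinearMap.sub_apply, map_sub, ← h1, sub_eq_zero, LinearMap.sum_apply, map_sum]
    exact Finset.sum_congr rfl fun j _ =>
      hE.apply_comm (θ ∘ₗ LinearMap.single R (fun _ => E) j) l _
  · have h1 : f x = 0 := hf hx
    rw [LinearMap.mem_ker, LinearMap.sub_apply, h1, LinearMap.sum_apply, zero_sub, neg_eq_zero]
    refine Finset.sum_eq_zero fun j _ => ?_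
    have h2 : j.1.1 x = 0 := j.1.2 hx
    rw [LinearMap.comp_apply, h2, map_zero]
  · rw [LinearMap.sub_apply, LinearMap.sum_apply, Finset.sum_eq_zero, sub_zero]
    intro j _
    have h2 : j.1.1 x = 0 := congrFun hx.2 j
    rw [LinearMap.comp_apply, h2, map_zero]

end

/-- Homomorphisms into an injective module, given on the members of an increasing chain, extend
simultaneously. -/
theorem _root_.Module.Baer.exists_forall_eq {R N E : Type*} [CommRing R] [AddCommGroup N]
    [Module R N] [AddCommGroup E] [Module R E] (hE : Module.Baer R E) {F : ℕ → Submodule R N}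
    (hF : Monotone F) (g : ℕ → N →ₗ[R] E) (hg : ∀ k, ∀ x ∈ F k, g (k + 1) x = g k x) :
    ∃ g' : N →ₗ[R] E, ∀ k, ∀ x ∈ F k, g' x = g k x := by
  have hg' : ∀ k l, k ≤ l → ∀ x ∈ F k, g l x = g k x := by
    intro k l hkl x hx
    induction l, hkl using Nat.le_induction with
    | base => rfl
    | succ l hl ih => rw [hg l x (hF hl hx), ih]
  let p : ℕ → N →ₗ.[R] E := fun k => ⟨F k, (g k).domRestrict (F k)⟩
  have hp : Monotone p := fun k l hkl => ⟨hF hkl, fun x y hxy => by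
    change g k x = g l y
    rw [← hxy, hg' k l hkl x x.2]⟩
  have hdir : DirectedOn (· ≤ ·) (Set.range p) := by
    rintro _ ⟨k, rfl⟩ _ ⟨l, rfl⟩
    exact ⟨_, ⟨max k l, rfl⟩, hp (le_max_left k l), hp (le_max_right k l)⟩
  obtain ⟨g', hg''⟩ := hE.extension_property (LinearPMap.sSup _ hdir).domain.subtype
    (Submodule.injective_subtype _) (LinearPMap.sSup _ hdir).toFun
  refine ⟨g', fun k x hx => ?_⟩
  have hle : p k ≤ LinearPMap.sSup _ hdir := LinearPMap.le_sSup hdir ⟨k, rfl⟩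
  have h1 := LinearMap.congr_fun hg'' ⟨x, hle.1 hx⟩
  have h2 := hle.2 (x := (⟨x, hx⟩ : F k)) (y := ⟨x, hle.1 hx⟩) rfl
  exact h1.trans h2.symm

/-! ### Complemented modules with a surjective homothety -/

theorem exists_le_of_fg_of_monotone {R E : Type*} [CommRing R] [AddCommGroup E] [Module R E]
    {Y : Submodule R E} (hY : Y.FG) {A : ℕ → Submodule R E} (hA : Monotone A)
    (h : ∀ y ∈ Y, ∃ b, y ∈ A b) : ∃ b, Y ≤ A b := by
  induction Y, hY using Submodule.fg_induction with
  | singleton z =>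
    obtain ⟨b, hb⟩ := h z (Submodule.mem_span_singleton_self z)
    exact ⟨b, (Submodule.span_singleton_le_iff_mem _ _).2 hb⟩
  | sup Y₁ Y₂ _ _ ih₁ ih₂ =>
    obtain ⟨b₁, h₁⟩ := ih₁ fun y hy => h y (Submodule.mem_sup_left hy)
    obtain ⟨b₂, h₂⟩ := ih₂ fun y hy => h y (Submodule.mem_sup_right hy)
    exact ⟨max b₁ b₂, sup_le (h₁.trans (hA (le_max_left _ _))) (h₂.trans (hA (le_max_right _ _)))⟩

/-- Stable values can be realised independently of each other: `f n` maps `P n` onto `L n`, and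
vanishes on `P i` for `i ≠ n`. -/
theorem exists_seq_map_eq {R N E : Type*} [CommRing R] [AddCommGroup N] [Module R N]
    [AddCommGroup E] [Module R E] [IsArtinian R E] {F₀ X₀ : Submodule R N} (hF₀ : F₀.FG)
    (hX₀ : IsArtinian R (N ⧸ X₀)) {L : ℕ → Submodule R E} (hL : ∀ n, (L n).FG)
    (hLZ : ∀ n, L n ≤ stableValues R N E) :
    ∃ (f : ℕ → N →ₗ[R] E) (P F : ℕ → Submodule R N), F 0 = F₀ ∧ (∀ n, F (n + 1) = F n ⊔ P n) ∧
      (∀ n, F n ≤ LinearMap.ker (f n)) ∧ (∀ n, P n ≤ X₀) ∧ (∀ n, (P n).map (f n) = L n) ∧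
      ∀ i n, i < n → P n ≤ LinearMap.ker (f i) := by
  let Q := {q : Submodule R N × Submodule R N // q.1.FG ∧ IsArtinian R (N ⧸ q.2)}
  have step : ∀ (n : ℕ) (q : Q), ∃ (f : N →ₗ[R] E) (P : Submodule R N),
      q.1.1 ≤ LinearMap.ker f ∧ P.FG ∧ P ≤ q.1.2 ∧ P.map f = L n := fun n q =>
    exists_map_eq_of_fg q.2.1 q.2.2 (hL n) (hLZ n)
  choose f P hf hP hPX hmap using step
  obtain ⟨q, hq0, hqs⟩ : ∃ q : ℕ → Q, q 0 = ⟨(F₀, X₀), hF₀, hX₀⟩ ∧ ∀ n, q (n + 1) =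
      ⟨((q n).1.1 ⊔ P n (q n), (q n).1.2 ⊓ LinearMap.ker (f n (q n))), (q n).2.1.sup (hP n (q n)),
        isArtinian_quotient_inf (q n).2.2 (isArtinian_quotient_ker _)⟩ :=
    ⟨fun n => Nat.rec ⟨(F₀, X₀), hF₀, hX₀⟩ (fun n q => ⟨(q.1.1 ⊔ P n q,
      q.1.2 ⊓ LinearMap.ker (f n q)), q.2.1.sup (hP n q),
        isArtinian_quotient_inf q.2.2 (isArtinian_quotient_ker _)⟩) n, rfl, fun _ => rfl⟩
  have hX : Antitone fun n => (q n).1.2 := antitone_nat_of_succ_le fun n => by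
    rw [hqs]
    exact inf_le_left
  refine ⟨fun n => f n (q n), fun n => P n (q n), fun n => (q n).1.1, by beta_reduce; rw [hq0],
    fun n => by beta_reduce; rw [hqs], fun n => hf n _, fun n => ?_,
    fun n => hmap n _, fun i n hin => ?_⟩
  · refine (hPX n (q n)).trans ((hX (Nat.zero_le n)).trans ?_)
    beta_reduce
    rw [hq0]
  · refine (hPX n (q n)).trans ((hX (Nat.succ_le_of_lt hin)).trans ?_)
    beta_reduce
    rw [Nat.succ_eq_add_one, hqs]
    exact inf_le_right

/-- If `N` is complemented and `rN = N` for some `r ∈ 𝔪`, then `N` is an extension of an artinian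
module by a finitely generated one. For `E` the injective hull of the residue field, it is enough to
show that all stable values of homomorphisms `N → E` are zero. The stable values in `E[𝔪ⁿ]` are
realised by `f n : N → E` on `F n ⊆ N`; since `rⁿN = N`, a complement `V` of `U = ⋃ F n` contains
elements of `U` with the same values. A suitable subsequence of the `f n` adds up to a homomorphism
on `U`, which extends to `N` and can be chosen to have stable values only, all of which it takes
on `V ∩ U`. By the minimality of `V` it vanishes on `V`. -/
theorem IsComplemented.exists_fg_isArtinian_quotient {R N : Type*} [CommRing R] [IsLocalRing R]
    [IsNoetherianRing R] [AddCommGroup N] [Module R N] (hN : IsComplemented R N) {r : R}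
    (hr : r ∈ maximalIdeal R) (hdiv : ∀ x : N, ∃ y, r • y = x) :
    ∃ F : Submodule R N, F.FG ∧ IsArtinian R (N ⧸ F) := by
  obtain ⟨E, s, hE⟩ := exists_isResidueHull R
  have := hE.isArtinian
  obtain ⟨F₀, X₀, hF₀, hX₀, hZ₀⟩ := exists_apply_mem_stableValues (R := R) (N := N) (E := E)
  set Z := stableValues R N E
  obtain ⟨X₁, -, hX₁, hext⟩ := hE.exists_forall_apply_mem hX₀ hZ₀
  let L : ℕ → Submodule R E := fun n =>
    Z ⊓ Submodule.torsionBySet R E (maximalIdeal R ^ n : Ideal R)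
  have hLFG : ∀ n, (L n).FG := fun n => by
    have := hE.isNoetherian_torsionBySet n
    have : IsNoetherian R (L n) := isNoetherian_of_le (inf_le_right : L n ≤ _)
    exact (Submodule.fg_top _).1 (IsNoetherian.noetherian ⊤)
  have hLr : ∀ n i, i ≤ n → ∀ y ∈ L i, r ^ n • y = 0 := fun n i hin y hy =>
    (Submodule.mem_torsionBySet_iff _ _).1 hy.2
      ⟨r ^ n, Ideal.pow_le_pow_right hin (Ideal.pow_mem_pow hr n)⟩
  obtain ⟨f, P, F, hF0, hFs, hFf, hPX, hmap, hPf⟩ :=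
    exists_seq_map_eq hF₀ hX₁ hLFG (fun n => inf_le_left)
  have hF : Monotone F := monotone_nat_of_le_succ fun n => (hFs n).symm ▸ le_sup_left
  have hPker : ∀ i n, i ≠ n → P n ≤ LinearMap.ker (f i) := by
    intro i n hin
    rcases lt_or_gt_of_ne hin with h | h
    · exact hPf i n h
    · refine le_trans ?_ (hFf i)
      exact le_trans ((hFs n).symm ▸ le_sup_right) (hF (Nat.succ_le_of_lt h))
  have hFL : ∀ i n, F n ≤ (L i).comap (f i) := by
    intro i n
    induction n with
    | zero =>
      intro x hx
      have h1 : f i x = 0 := hFf i (hF (Nat.zero_le i) hx)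
      rw [Submodule.mem_comap, h1]
      exact zero_mem _
    | succ n ih =>
      rw [hFs]
      refine sup_le ih ?_
      by_cases hin : i = n
      · subst hin
        rw [← Submodule.map_le_iff_le_comap, hmap]
      · intro x hx
        have h1 : f i x = 0 := hPker i n hin hx
        rw [Submodule.mem_comap, h1]
        exact zero_mem _
  have hFX : ∀ n, F n ≤ F₀ ⊔ X₁ := by
    intro n
    induction n with
    | zero => rw [hF0]; exact le_sup_left
    | succ n ih => rw [hFs]; exact sup_le ih ((hPX n).trans le_sup_right)
  set U := ⨆ n, F n
  have hmemU : ∀ x, x ∈ U ↔ ∃ n, x ∈ F n := fun x =>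
    Submodule.mem_iSup_of_directed F hF.directed_le
  obtain ⟨V, hV⟩ := hN U
  have hrpow : ∀ (n : ℕ) (x : N), ∃ y, r ^ n • y = x := by
    intro n
    induction n with
    | zero => exact fun x => ⟨x, by rw [pow_zero, one_smul]⟩
    | succ n ih =>
      intro x
      obtain ⟨y, rfl⟩ := ih x
      obtain ⟨z, rfl⟩ := hdiv y
      exact ⟨z, by rw [pow_succ, mul_smul]⟩
  let A : ℕ → ℕ → Submodule R N := fun n b => V ⊓ F b ⊓ ⨅ i, ⨅ _ : i < n, LinearMap.ker (f i)
  have hAmono : ∀ n, Monotone (A n) := fun n b c hbc =>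
    inf_le_inf_right _ (inf_le_inf_left _ (hF hbc))
  have hval : ∀ n, ∀ y ∈ L n, ∃ b, y ∈ (A n b).map (f n) := by
    intro n y hy
    rw [← hmap n] at hy
    obtain ⟨u, hu, rfl⟩ := hy
    obtain ⟨w, rfl⟩ := hrpow n u
    obtain ⟨v, hv, u', hu', rfl⟩ := Submodule.mem_sup.1 (hV.prop.ge (Submodule.mem_top (x := w)))
    obtain ⟨b, hb⟩ := (hmemU u').1 hu'
    have hfu' : ∀ i ≤ n, f i (r ^ n • u') = 0 := fun i hi => by
      rw [map_smul]
      exact hLr n i hi _ (hFL i b hb)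
    have hv' : r ^ n • v = r ^ n • (v + u') - r ^ n • u' := by rw [smul_add, add_sub_cancel_right]
    refine ⟨max b (n + 1), r ^ n • v, ⟨⟨V.smul_mem _ hv, ?_⟩, ?_⟩, ?_⟩
    · rw [hv']
      refine sub_mem (hF (le_max_right _ _) ?_) ((F _).smul_mem _ (hF (le_max_left _ _) hb))
      rw [hFs]
      exact Submodule.mem_sup_right hu
    · simp only [SetLike.mem_coe, Submodule.mem_iInf]
      intro i hi
      have h1 : f i (r ^ n • (v + u')) = 0 := hPker i n hi.ne hu
      rw [LinearMap.mem_ker, hv', map_sub, h1, hfu' i hi.le, sub_zero]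
    · rw [hv', map_sub, hfu' n le_rfl, sub_zero]
  have hb : ∀ n, ∃ b, n < b ∧ L n ≤ (A n b).map (f n) := by
    intro n
    obtain ⟨b, hb⟩ := exists_le_of_fg_of_monotone (hLFG n)
      (fun b c hbc => Submodule.map_mono (hAmono n hbc)) (hval n)
    exact ⟨max b (n + 1), lt_of_lt_of_le n.lt_succ_self (le_max_right _ _),
      hb.trans (Submodule.map_mono (hAmono n (le_max_left _ _)))⟩
  choose b hnb hLb using hb
  obtain ⟨ν, hν0, hνs⟩ : ∃ ν : ℕ → ℕ, ν 0 = 0 ∧ ∀ k, ν (k + 1) = b (ν k) :=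
    ⟨fun k => Nat.rec 0 (fun _ m => b m) k, rfl, fun _ => rfl⟩
  have hν : StrictMono ν := strictMono_nat_of_lt_succ fun k => (hνs k).symm ▸ hnb _
  -- on `F (ν k)` all but the first `k` of the maps `f (ν j)` vanish
  obtain ⟨g, hg⟩ := hE.baer.exists_forall_eq (hF.comp hν.monotone)
    (fun k => ∑ j ∈ Finset.range k, f (ν j)) (fun k x hx => by
      have h1 : f (ν k) x = 0 := hFf _ hx
      rw [Finset.sum_range_succ, LinearMap.add_apply, h1, add_zero])
  have hgF₀ : F₀ ≤ LinearMap.ker g := fun x hx => by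
    have h1 := hg 0 x (by rwa [Function.comp_apply, hν0, hF0])
    rwa [Finset.sum_range_zero, LinearMap.zero_apply] at h1
  obtain ⟨g', hg'Z, hg'F₀, hg'X⟩ := hext g hgF₀
  have hg'U : ∀ x ∈ U, g' x = g x := by
    intro x hx
    obtain ⟨n, hn⟩ := (hmemU x).1 hx
    obtain ⟨x₀, hx₀, x₁, hx₁, rfl⟩ := Submodule.mem_sup.1 (hFX n hn)
    have h1 : g x₀ = 0 := hgF₀ hx₀
    have h2 : g' x₀ = 0 := hg'F₀ hx₀
    rw [map_add, map_add, h1, h2, hg'X x₁ hx₁]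
  have hsurj : ∀ z ∈ Z, ∃ s ∈ V ⊓ U, g' s = z := by
    intro z hz
    obtain ⟨k, hk⟩ := hE.exists_mem_torsionBySet z
    have hzL : z ∈ L (ν k) := ⟨hz, (Submodule.mem_torsionBySet_iff _ _).2 fun c =>
      (Submodule.mem_torsionBySet_iff _ _).1 hk ⟨c, Ideal.pow_le_pow_right hν.le_apply c.2⟩⟩
    obtain ⟨s, ⟨⟨hsV, hsF⟩, hsf⟩, hsz⟩ := hLb _ hzL
    simp only [SetLike.mem_coe, Submodule.mem_iInf] at hsf
    have hsU : s ∈ U := (hmemU s).2 ⟨_, hsF⟩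
    refine ⟨s, ⟨hsV, hsU⟩, ?_⟩
    rw [hg'U s hsU, hg (k + 1) s (by rw [Function.comp_apply, hνs]; exact hsF),
      Finset.sum_range_succ, LinearMap.add_apply, LinearMap.sum_apply, hsz, Finset.sum_eq_zero,
      zero_add]
    exact fun j hj => hsf _ (hν (Finset.mem_range.1 hj))
  have hV' : (V ⊓ LinearMap.ker g') ⊔ U = ⊤ := by
    refine eq_top_iff.2 (hV.prop.ge.trans (sup_le (fun v hv => ?_) le_sup_right))
    obtain ⟨s, hs, hsv⟩ := hsurj _ (hg'Z v)
    rw [← sub_add_cancel v s]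
    exact Submodule.add_mem_sup ⟨V.sub_mem hv hs.1, LinearMap.mem_ker.2 (by
      rw [map_sub, hsv, sub_self])⟩ hs.2
  have hVker : V ≤ LinearMap.ker g' := (hV.le_of_le hV' inf_le_left).trans inf_le_right
  have hX₀F₀ : X₀ ≤ F₀ := by
    intro x hx
    by_contra hxF
    obtain ⟨l, hl, hlx⟩ := hE.exists_apply_ne_zero hxF
    obtain ⟨s, hs, hsl⟩ := hsurj _ (hZ₀ l hl x hx)
    exact hlx (hsl.symm.trans (hVker hs.1))
  exact ⟨F₀, hF₀, isArtinian_quotient_of_le hX₀F₀ hX₀⟩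

/-! ### Extending homomorphisms from the ring to its fraction field -/

/-- Cosets of submodules of an artinian module satisfy the descending chain condition. -/
theorem exists_forall_affineSubspace_le {R X ι : Type*} [CommRing R] [AddCommGroup X] [Module R X]
    [Nonempty ι] (A : ι → AffineSubspace R X) (hA : Directed (· ≥ ·) A) (T : Submodule R X)
    [IsArtinian R T] (hne : ∀ i, (A i : Set X).Nonempty) (hT : ∀ i, (A i).direction ≤ T) :
    ∃ i, ∀ j, A i ≤ A j := by
  obtain ⟨_, ⟨i, rfl⟩, hmin⟩ := IsArtinian.set_has_minimal
    (Set.range fun i => (A i).direction.comap T.subtype) (Set.range_nonempty _)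
  refine ⟨i, fun j => ?_⟩
  obtain ⟨k, hki, hkj⟩ := hA i j
  have h1 : (A k).direction = (A i).direction := by
    refine le_antisymm (AffineSubspace.direction_le hki) fun x hx => ?_
    by_contra hxk
    refine hmin _ ⟨k, rfl⟩ (lt_of_le_not_ge
      (Submodule.comap_mono (AffineSubspace.direction_le hki)) fun hle => hxk ?_)
    exact hle (show (⟨x, hT i hx⟩ : T) ∈ (A i).direction.comap T.subtype from hx)
  rwa [← AffineSubspace.eq_of_direction_eq_of_nonempty_of_le h1 (hne k) hki]

section

variable {R X : Type*} [CommRing R] [AddCommGroup X] [Module R X]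

/-- A compatible choice of cosets in the sets of solutions `y` of `r • y = x`, for `r ≠ 0`. -/
structure IsQuotientSystem (x : X) (C : R → AffineSubspace R X) : Prop where
  nonempty : ∀ r ≠ 0, (C r : Set X).Nonempty
  smul_eq : ∀ r ≠ 0, ∀ y ∈ C r, r • y = x
  smul_mem : ∀ r ≠ 0, ∀ t ≠ 0, ∀ y ∈ C (r * t), t • y ∈ C r

theorem IsQuotientSystem.direction_le {x : X} {C : R → AffineSubspace R X}
    (hC : IsQuotientSystem x C) {r : R} (hr : r ≠ 0) :
    (C r).direction ≤ Submodule.torsionBy R X r := by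
  intro v hv
  obtain ⟨y, hy, z, hz, rfl⟩ :=
    (AffineSubspace.mem_direction_iff_eq_vsub (hC.nonempty r hr) v).1 hv
  rw [Submodule.mem_torsionBy_iff, vsub_eq_sub, smul_sub, hC.smul_eq r hr y hy,
    hC.smul_eq r hr z hz, sub_self]

/-- The image of an affine subspace under multiplication by `r`. -/
def smulAffine (r : R) (A : AffineSubspace R X) : AffineSubspace R X :=
  A.map (LinearMap.lsmul R X r).toAffineMap

theorem mem_smulAffine {r : R} {A : AffineSubspace R X} {x : X} :
    x ∈ smulAffine r A ↔ ∃ y ∈ A, r • y = x := Iff.rfl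

/-- Compatible quotients `x / r` exist in a divisible module `X` with all `X[r]`, `r ≠ 0`,
artinian. A system of cosets of candidates which is minimal consists of single elements: otherwise
it could be replaced by the intersections of the `t • C (r * t)`, or by the part of it compatible
with the choice of one element in one `C r`. -/
theorem exists_forall_smul_eq [IsDomain R] (hX : IsDivisible R X)
    (hart : ∀ r : R, r ≠ 0 → IsArtinian R (Submodule.torsionBy R X r)) (x : X) :
    ∃ y : R → X, (∀ r ≠ 0, r • y r = x) ∧ ∀ r ≠ 0, ∀ t ≠ 0, t • y (r * t) = y r := by
  let B : R → AffineSubspace R X := fun r =>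
    (affineSpan R {x}).comap (LinearMap.lsmul R X r).toAffineMap
  have hBmem : ∀ r y, y ∈ B r ↔ r • y = x := fun r y => by
    rw [AffineSubspace.mem_comap, AffineSubspace.mem_affineSpan_singleton]
    rfl
  have hB : IsQuotientSystem x B := by
    refine ⟨fun r hr => ?_, fun r _ y hy => (hBmem r y).1 hy, fun r _ t _ y hy => ?_⟩
    · obtain ⟨y, hy⟩ := hX r hr x
      exact ⟨y, (hBmem r y).2 hy⟩
    · rw [hBmem, ← mul_smul]
      exact (hBmem _ _).1 hy
  obtain ⟨C, -, hC, hCmin⟩ := zorn_le_nonempty₀ (α := (R → AffineSubspace R X)ᵒᵈ)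
    {C | IsQuotientSystem x (OrderDual.ofDual C)} (by
      intro c hc hchain C₀ hC₀
      have hle : ∀ r, r ≠ 0 → ∃ C : c, ∀ C' : c,
          OrderDual.ofDual C.1 r ≤ OrderDual.ofDual C'.1 r := by
        intro r hr
        have := hart r hr
        have : Nonempty c := ⟨⟨C₀, hC₀⟩⟩
        refine exists_forall_affineSubspace_le (fun C : c => OrderDual.ofDual C.1 r) ?_
          (Submodule.torsionBy R X r) (fun C => (hc C.2).nonempty r hr)
          (fun C => (hc C.2).direction_le hr)
        intro C C'
        rcases hchain.total C.2 C'.2 with h | h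
        · exact ⟨C', h r, le_rfl⟩
        · exact ⟨C, le_rfl, h r⟩
      refine ⟨OrderDual.toDual fun r => ⨅ C : c, OrderDual.ofDual C.1 r,
        ⟨fun r hr => ?_, fun r hr y hy => ?_, fun r hr t ht y hy => ?_⟩, fun C hC r => ?_⟩
      · obtain ⟨C, hC⟩ := hle r hr
        obtain ⟨y, hy⟩ := (hc C.2).nonempty r hr
        exact ⟨y, (AffineSubspace.mem_iInf_iff _ _).2 fun C' => hC C' hy⟩
      · exact (hc hC₀).smul_eq r hr y ((AffineSubspace.mem_iInf_iff _ _).1 hy ⟨C₀, hC₀⟩)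
      · refine (AffineSubspace.mem_iInf_iff _ _).2 fun C => ?_
        exact (hc C.2).smul_mem r hr t ht y ((AffineSubspace.mem_iInf_iff _ _).1 hy C)
      · exact iInf_le (fun C : c => OrderDual.ofDual C.1 r) ⟨C, hC⟩) (OrderDual.toDual B) hB
  change R → AffineSubspace R X at C
  replace hC : IsQuotientSystem x C := hC
  replace hCmin : ∀ C' : R → AffineSubspace R X, IsQuotientSystem x C' → C' ≤ C → C ≤ C' :=
    fun C' h h' => hCmin (y := OrderDual.toDual C') h h'
  have hsmul : ∀ r ≠ 0, ∀ t ≠ 0, ∀ y ∈ C r, ∃ z ∈ C (r * t), t • z = y := by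
    intro r _ t ht
    have hle : C ≤ fun r => ⨅ t : {t : R // t ≠ 0}, smulAffine t.1 (C (r * t)) := by
      refine hCmin _ ⟨fun r hr => ?_, fun r hr y hy => ?_, fun r hr s hs y hy => ?_⟩
        fun r y hy => ?_
      · have := hart r hr
        have : Nonempty {t : R // t ≠ 0} := ⟨⟨1, one_ne_zero⟩⟩
        have hsub : ∀ t : {t : R // t ≠ 0}, smulAffine t.1 (C (r * t)) ≤ C r := by
          rintro t _ ⟨y, hy, rfl⟩
          exact hC.smul_mem r hr t t.2 y hy
        obtain ⟨t, h⟩ := exists_forall_affineSubspace_le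
          (fun t : {t : R // t ≠ 0} => smulAffine t.1 (C (r * t))) (fun t t' => by
            refine ⟨⟨t.1 * t'.1, mul_ne_zero t.2 t'.2⟩, ?_, ?_⟩
            · rintro _ ⟨y, hy, rfl⟩
              refine ⟨t'.1 • y, hC.smul_mem _ (mul_ne_zero hr t.2) _ t'.2 y ?_, ?_⟩
              · rwa [mul_assoc]
              · exact (mul_smul _ _ _).symm
            · rintro _ ⟨y, hy, rfl⟩
              refine ⟨t.1 • y, hC.smul_mem _ (mul_ne_zero hr t'.2) _ t.2 y ?_, ?_⟩
              · rwa [mul_assoc, mul_comm t'.1]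
              · change t'.1 • t.1 • y = (t.1 * t'.1) • y
                rw [← mul_smul, mul_comm])
          (Submodule.torsionBy R X r) (fun t => by
            obtain ⟨y, hy⟩ := hC.nonempty (r * t) (mul_ne_zero hr t.2)
            exact ⟨t.1 • y, y, hy, rfl⟩)
          (fun t => (AffineSubspace.direction_le (hsub t)).trans (hC.direction_le hr))
        obtain ⟨y, hy⟩ := hC.nonempty (r * t) (mul_ne_zero hr t.2)
        exact ⟨t.1 • y, (AffineSubspace.mem_iInf_iff _ _).2 fun t' => h t' ⟨y, hy, rfl⟩⟩
      · obtain ⟨z, hz, rfl⟩ := (AffineSubspace.mem_iInf_iff _ _).1 hy ⟨1, one_ne_zero⟩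
        exact hC.smul_eq r hr _ (hC.smul_mem r hr 1 one_ne_zero z hz)
      · refine (AffineSubspace.mem_iInf_iff _ _).2 fun t => ?_
        obtain ⟨z, hz, rfl⟩ := (AffineSubspace.mem_iInf_iff _ _).1 hy t
        refine ⟨s • z, hC.smul_mem _ (mul_ne_zero hr t.2) s hs z ?_, smul_comm _ _ _⟩
        rwa [mul_right_comm]
      · obtain ⟨z, hz, rfl⟩ := (AffineSubspace.mem_iInf_iff _ _).1 hy ⟨1, one_ne_zero⟩
        change (1 : R) • z ∈ C r
        rwa [one_smul, ← mul_one r]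
    intro y hy
    exact mem_smulAffine.1 ((AffineSubspace.mem_iInf_iff _ _).1 (hle r hy) ⟨t, ht⟩)
  have hsing : ∀ r ≠ 0, ∀ y ∈ C r, ∀ w ∈ C r, w = y := by
    intro r₀ hr₀ y hy w hw
    have hle : C ≤ fun r => C r ⊓ smulAffine r₀ (C (r * r₀) ⊓
        (affineSpan R {y}).comap (LinearMap.lsmul R X r).toAffineMap) := by
      refine hCmin _ ⟨fun r hr => ?_, fun r hr y hy => hC.smul_eq r hr y hy.1,
        fun r hr t ht v hv => ⟨hC.smul_mem r hr t ht v hv.1, ?_⟩⟩ fun r => inf_le_left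
      · obtain ⟨z, hz, hzy⟩ := hsmul r₀ hr₀ r hr y hy
        rw [mul_comm] at hz
        refine ⟨r₀ • z, hC.smul_mem r hr r₀ hr₀ z hz, z, ⟨hz, ?_⟩, rfl⟩
        rw [SetLike.mem_coe, AffineSubspace.mem_comap, AffineSubspace.mem_affineSpan_singleton]
        exact hzy
      · obtain ⟨z, ⟨hz, hzy⟩, rfl⟩ := hv.2
        rw [SetLike.mem_coe, AffineSubspace.mem_comap,
          AffineSubspace.mem_affineSpan_singleton] at hzy
        refine ⟨t • z, ⟨hC.smul_mem _ (mul_ne_zero hr hr₀) t ht z ?_, ?_⟩, smul_comm _ _ _⟩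
        · rwa [mul_right_comm]
        · rw [SetLike.mem_coe, AffineSubspace.mem_comap, AffineSubspace.mem_affineSpan_singleton]
          exact (mul_smul r t z).symm.trans hzy
    obtain ⟨z, ⟨-, hzy⟩, hzw⟩ := (hle r₀ hw).2
    rw [SetLike.mem_coe, AffineSubspace.mem_comap,
      AffineSubspace.mem_affineSpan_singleton] at hzy
    exact hzw.symm.trans hzy
  have hne : ∀ r : R, ∃ y, r ≠ 0 → y ∈ C r := fun r => by
    by_cases hr : r = 0
    · exact ⟨0, fun h => absurd hr h⟩
    · obtain ⟨y, hy⟩ := hC.nonempty r hr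
      exact ⟨y, fun _ => hy⟩
  choose y hy using hne
  exact ⟨y, fun r hr => hC.smul_eq r hr _ (hy r hr), fun r hr t ht => hsing r hr _ (hy r hr) _
    (hC.smul_mem r hr t ht _ (hy _ (mul_ne_zero hr ht)))⟩

theorem exists_linearMap_apply_one_eq (K : Type*) [Field K] [IsDomain R] [Algebra R K]
    [IsFractionRing R K] (hX : IsDivisible R X)
    (hart : ∀ r : R, r ≠ 0 → IsArtinian R (Submodule.torsionBy R X r)) (x : X) :
    ∃ φ : K →ₗ[R] X, φ 1 = x := by
  obtain ⟨y, hy, hyt⟩ := exists_forall_smul_eq hX hart x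
  have hfrac : ∀ k : K, ∃ (a r : R), r ≠ 0 ∧ algebraMap R K a = algebraMap R K r * k := by
    intro k
    obtain ⟨a, r, hr, rfl⟩ := IsFractionRing.div_surjective (A := R) k
    have hr0 := nonZeroDivisors.ne_zero hr
    refine ⟨a, r, hr0, ?_⟩
    rw [mul_div_cancel₀]
    exact (map_ne_zero_iff _ (IsFractionRing.injective R K)).2 hr0
  choose a r hr har using hfrac
  have huniq : ∀ (k : K) (b s : R), s ≠ 0 → algebraMap R K b = algebraMap R K s * k →
      a k • y (r k) = b • y s := by
    intro k b s hs hbs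
    have h1 : a k * s = b * r k := by
      apply IsFractionRing.injective R K
      rw [map_mul, map_mul, har, hbs]
      ring
    rw [← hyt (r k) (hr k) s hs, ← hyt s hs (r k) (hr k), ← mul_smul, ← mul_smul, h1,
      mul_comm s]
  refine ⟨⟨⟨fun k => a k • y (r k), fun k l => ?_⟩, fun c k => ?_⟩, ?_⟩
  · rw [huniq (k + l) (a k * r l + a l * r k) (r k * r l) (mul_ne_zero (hr k) (hr l)) (by
      rw [map_add, map_mul, map_mul, map_mul, har, har]
      ring), add_smul, mul_smul, mul_smul, hyt (r k) (hr k) (r l) (hr l), mul_comm (r k),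
      hyt (r l) (hr l) (r k) (hr k)]
  · change a (c • k) • y (r (c • k)) = c • a k • y (r k)
    rw [huniq (c • k) (c * a k) (r k) (hr k) (by
      rw [map_mul, har, Algebra.smul_def]
      ring), mul_smul]
  · change a 1 • y (r 1) = x
    rw [huniq 1 1 1 one_ne_zero (by rw [mul_one]), hy 1 one_ne_zero]

end

/-! ### The bounded and the finitely generated part -/

theorem exists_fg_le_map_eq {R A B : Type*} [CommRing R] [AddCommGroup A] [Module R A]
    [AddCommGroup B] [Module R B] (f : A →ₗ[R] B) {V : Submodule R A} {F : Submodule R B}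
    (hF : F.FG) (hFV : F ≤ V.map f) : ∃ W ≤ V, W.FG ∧ W.map f = F := by
  induction F, hF using Submodule.fg_induction with
  | singleton z =>
    obtain ⟨x, hx, rfl⟩ := hFV (Submodule.mem_span_singleton_self z)
    exact ⟨R ∙ x, (Submodule.span_singleton_le_iff_mem _ _).2 hx, Submodule.fg_span_singleton x, by
      rw [Submodule.map_span, Set.image_singleton]⟩
  | sup F₁ F₂ _ _ ih₁ ih₂ =>
    obtain ⟨W₁, hW₁, hfg₁, rfl⟩ := ih₁ (le_sup_left.trans hFV)
    obtain ⟨W₂, hW₂, hfg₂, rfl⟩ := ih₂ (le_sup_right.trans hFV)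
    exact ⟨W₁ ⊔ W₂, sup_le hW₁ hW₂, hfg₁.sup hfg₂, Submodule.map_sup _ _ _⟩

/-- If `V` is a complement of `rM`, then `rV` is small in `V`, so that some `rᵉ V` is finitely
generated; and `r` acts surjectively on the complemented module `M ⧸ V`. -/
theorem IsComplemented.exists_fg_map_pow_lsmul {R M : Type*} [CommRing R] [IsLocalRing R]
    [IsNoetherianRing R] [AddCommGroup M] [Module R M] (hM : IsComplemented R M) {r : R}
    (hr : r ∈ maximalIdeal R) : ∃ (V : Submodule R M) (e : ℕ),
      (V.map (LinearMap.lsmul R M (r ^ e))).FG ∧ IsArtinian R (M ⧸ V) := by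
  obtain ⟨V, hV⟩ := hM (LinearMap.range (LinearMap.lsmul R M r))
  -- `rV` is small in `V`, by minimality
  have hsmall : ∀ X : Submodule R V, X ⊔ LinearMap.range (LinearMap.lsmul R V r) = ⊤ → X = ⊤ := by
    intro X hX
    have h1 : X.map V.subtype ⊔ LinearMap.range (LinearMap.lsmul R M r) = ⊤ := by
      refine eq_top_iff.2 (hV.prop.ge.trans (sup_le (fun v hv => ?_) le_sup_right))
      obtain ⟨x, hx, _, ⟨w, rfl⟩, hxw⟩ :=
        Submodule.mem_sup.1 (hX.ge (Submodule.mem_top (x := (⟨v, hv⟩ : V))))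
      exact Submodule.mem_sup.2 ⟨x, ⟨x, hx, rfl⟩, r • (w : M), ⟨w, rfl⟩, congrArg Subtype.val hxw⟩
    have h2 : V ≤ X.map V.subtype := hV.le_of_le h1 (Submodule.map_subtype_le _ _)
    refine eq_top_iff.2 fun v _ => ?_
    obtain ⟨x, hx, hxv⟩ := h2 v.2
    rwa [← Subtype.ext (show (x : M) = v from hxv)]
  obtain ⟨e, he⟩ : ∃ e : ℕ, (LinearMap.range (LinearMap.lsmul R V (r ^ e))).FG := by
    by_contra! hcon
    obtain ⟨X, hX, hXr⟩ := exists_sup_range_lsmul_eq_top hcon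
    exact hX (hsmall X hXr)
  obtain ⟨F, hF, hart⟩ := (hM.of_surjective V.mkQ V.mkQ_surjective).exists_fg_isArtinian_quotient
    hr (fun q => by
      obtain ⟨x, rfl⟩ := V.mkQ_surjective q
      obtain ⟨v, hv, _, ⟨y, rfl⟩, rfl⟩ :=
        Submodule.mem_sup.1 (hV.prop.ge (Submodule.mem_top (x := x)))
      refine ⟨V.mkQ y, ?_⟩
      rw [map_add, ← map_smul, Submodule.mkQ_apply _ v, (Submodule.Quotient.mk_eq_zero V).2 hv,
        zero_add]
      rfl)
  obtain ⟨W, -, hW, rfl⟩ := exists_fg_le_map_eq (V := ⊤) V.mkQ hF (by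
    rw [Submodule.map_top, V.range_mkQ]
    exact le_top)
  refine ⟨V ⊔ W, e, ?_, ?_⟩
  · rw [Submodule.map_sup]
    refine Submodule.FG.sup ?_ (hW.map _)
    have h1 : V.map (LinearMap.lsmul R M (r ^ e)) =
        (LinearMap.range (LinearMap.lsmul R V (r ^ e))).map V.subtype := by
      ext x
      constructor
      · rintro ⟨v, hv, rfl⟩
        exact ⟨_, ⟨⟨v, hv⟩, rfl⟩, rfl⟩
      · rintro ⟨_, ⟨v, rfl⟩, rfl⟩
        exact ⟨v, v.2, rfl⟩
    rw [h1]
    exact he.map _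
  · have h1 := isArtinian_quotient_ker ((W.map V.mkQ).mkQ ∘ₗ V.mkQ)
    rwa [LinearMap.ker_comp, Submodule.ker_mkQ, Submodule.comap_map_mkQ] at h1

/-- The submodule `V₁` of `IsComplemented.exists_fg_map_pow_lsmul` is enlarged until `M ⧸ V` becomes
divisible. Then a complement of `V` in `M` is divisible. -/
theorem IsComplemented.exists_sup_divisiblePart_eq_top {R M : Type*} [CommRing R] [IsDomain R]
    [IsLocalRing R] [IsNoetherianRing R] [AddCommGroup M] [Module R M] (hM : IsComplemented R M)
    {r : R} (hr0 : r ≠ 0) (hr : r ∈ maximalIdeal R) : ∃ (V : Submodule R M) (c : R), c ≠ 0 ∧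
      (V.map (LinearMap.lsmul R M c)).FG ∧ IsArtinian R (M ⧸ V) ∧ V ⊔ divisiblePart R M = ⊤ := by
  obtain ⟨V₁, e, hfg, hart⟩ := hM.exists_fg_map_pow_lsmul hr
  obtain ⟨_, ⟨r₀, hr₀, rfl⟩, hmin⟩ := IsArtinian.set_has_minimal
    {S : Submodule R (M ⧸ V₁) | ∃ r₀ : R, r₀ ≠ 0 ∧ S = LinearMap.range (LinearMap.lsmul R _ r₀)}
    ⟨_, 1, one_ne_zero, rfl⟩
  -- `M ⧸ V` is isomorphic to `r₀ (M ⧸ V₁)`, which is divisible by the choice of `r₀`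
  let V : Submodule R M := V₁.comap (LinearMap.lsmul R M r₀)
  have hV : ∀ s : R, s ≠ 0 → ∀ x : M, ∃ y : M, x - s • y ∈ V := by
    intro s hs x
    have hle : LinearMap.range (LinearMap.lsmul R (M ⧸ V₁) r₀) ≤
        LinearMap.range (LinearMap.lsmul R (M ⧸ V₁) (r₀ * s)) := by
      by_contra hnot
      refine hmin _ ⟨r₀ * s, mul_ne_zero hr₀ hs, rfl⟩ (lt_of_le_not_ge ?_ hnot)
      rintro _ ⟨q, rfl⟩
      exact ⟨s • q, (mul_smul r₀ s q).symm⟩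
    obtain ⟨q, hq⟩ := hle ⟨V₁.mkQ x, rfl⟩
    obtain ⟨y, rfl⟩ := V₁.mkQ_surjective q
    refine ⟨y, ?_⟩
    change r₀ • (x - s • y) ∈ V₁
    rw [← Submodule.Quotient.mk_eq_zero, smul_sub, Submodule.Quotient.mk_sub, sub_eq_zero,
      ← mul_smul]
    exact hq.symm
  obtain ⟨W, hW⟩ := hM V
  have hWD : W ≤ divisiblePart R M := by
    refine le_sSup fun s hs x => ?_
    obtain ⟨y, hy, hyx⟩ := hW.smul_surjective (hV s hs) x.2
    exact ⟨⟨y, hy⟩, Subtype.ext hyx⟩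
  refine ⟨V, r ^ e * r₀, mul_ne_zero (pow_ne_zero e hr0) hr₀, hfg.of_le ?_, ?_, ?_⟩
  · rintro _ ⟨x, hx, rfl⟩
    exact ⟨r₀ • x, hx, (mul_smul (r ^ e) r₀ x).symm⟩
  · have h1 := isArtinian_quotient_ker (V₁.mkQ ∘ₗ LinearMap.lsmul R M r₀)
    rwa [LinearMap.ker_comp, Submodule.ker_mkQ] at h1
  · rw [eq_top_iff, ← hW.prop, sup_comm W]
    exact sup_le_sup_left hWD V

/-- If `c V` is generated by the multiples `c w` of finitely many `w ∈ V`, then `V` is generated by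
these `w` and its submodule annihilated by `c`. -/
theorem exists_bounded_sup_fg_eq {R M : Type*} [CommRing R] [AddCommGroup M] [Module R M]
    {V : Submodule R M} {c : R} (hc : c ≠ 0) (hV : (V.map (LinearMap.lsmul R M c)).FG) :
    ∃ M₁ M₂ : Submodule R M, IsBounded R M₁ ∧ M₂.FG ∧ M₁ ⊔ M₂ = V := by
  obtain ⟨W, hWV, hW, hmap⟩ := exists_fg_le_map_eq _ hV le_rfl
  refine ⟨V ⊓ Submodule.torsionBy R M c, W, ⟨c, hc, fun x => Subtype.ext ?_⟩, hW,
    le_antisymm (sup_le inf_le_left hWV) fun x hx => ?_⟩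
  · exact (Submodule.mem_torsionBy_iff _ _).1 x.2.2
  · obtain ⟨w, hw, hwx⟩ := hmap.ge ⟨x, hx, rfl⟩
    rw [← sub_add_cancel x w]
    refine Submodule.add_mem_sup ⟨V.sub_mem hx (hWV hw), (Submodule.mem_torsionBy_iff _ _).2 ?_⟩ hw
    rw [smul_sub, sub_eq_zero]
    exact hwx.symm

/-! ### Divisible modules which are artinian modulo a finitely generated submodule -/

section

variable {R D : Type*} [CommRing R] [IsDomain R] [AddCommGroup D] [Module R D]

theorem exists_smul_eq_zero_of_fg {F : Submodule R D} (hF : F.FG)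
    (hT : ∀ x ∈ F, ∃ a : R, a ≠ 0 ∧ a • x = 0) : ∃ c : R, c ≠ 0 ∧ ∀ x ∈ F, c • x = 0 := by
  induction F, hF using Submodule.fg_induction with
  | singleton z =>
    obtain ⟨a, ha, haz⟩ := hT z (Submodule.mem_span_singleton_self z)
    refine ⟨a, ha, fun x hx => ?_⟩
    obtain ⟨b, rfl⟩ := Submodule.mem_span_singleton.1 hx
    rw [smul_comm, haz, smul_zero]
  | sup F₁ F₂ _ _ ih₁ ih₂ =>
    obtain ⟨a, ha, h₁⟩ := ih₁ fun x hx => hT x (Submodule.mem_sup_left hx)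
    obtain ⟨b, hb, h₂⟩ := ih₂ fun x hx => hT x (Submodule.mem_sup_right hx)
    refine ⟨a * b, mul_ne_zero ha hb, fun x hx => ?_⟩
    obtain ⟨y, hy, z, hz, rfl⟩ := Submodule.mem_sup.1 hx
    rw [smul_add, mul_smul a b z, h₂ z hz, mul_comm, mul_smul, h₁ y hy, smul_zero, smul_zero,
      add_zero]

theorem mem_torsion_iff_exists_ne_zero {x : D} :
    x ∈ Submodule.torsion R D ↔ ∃ a : R, a ≠ 0 ∧ a • x = 0 := by
  rw [Submodule.mem_torsion_iff]
  exact ⟨fun ⟨a, ha⟩ => ⟨a, nonZeroDivisors.ne_zero a.2, ha⟩,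
    fun ⟨a, ha, h⟩ => ⟨⟨a, mem_nonZeroDivisors_of_ne_zero ha⟩, h⟩⟩

/-- Some `c ≠ 0` annihilates `T ⊓ F`, where `T` is the torsion submodule. As `T` is divisible,
multiplication by `c` maps `T ⧸ (T ⊓ F)`, a submodule of `D ⧸ F`, onto `T`. -/
theorem IsDivisible.isArtinian_torsion [IsNoetherianRing R] (hD : IsDivisible R D)
    {F : Submodule R D} (hF : F.FG) (hart : IsArtinian R (D ⧸ F)) :
    IsArtinian R (Submodule.torsion R D) := by
  obtain ⟨c, hc, hcF⟩ := exists_smul_eq_zero_of_fg (F := Submodule.torsion R D ⊓ F)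
    (hF.of_le inf_le_right) fun x hx => mem_torsion_iff_exists_ne_zero.1 hx.1
  have := isArtinian_quotient_ker (F.mkQ ∘ₗ (Submodule.torsion R D).subtype)
  refine isArtinian_of_surjective _ ((LinearMap.ker (F.mkQ ∘ₗ
    (Submodule.torsion R D).subtype)).liftQ (LinearMap.lsmul R _ c) fun x hx => ?_) fun x => ?_
  · refine Subtype.ext (hcF x ⟨x.2, ?_⟩)
    exact (Submodule.Quotient.mk_eq_zero F).1 hx
  · obtain ⟨y, hy⟩ := hD c hc x
    obtain ⟨a, ha, hax⟩ := mem_torsion_iff_exists_ne_zero.1 x.2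
    refine ⟨Submodule.Quotient.mk ⟨y, mem_torsion_iff_exists_ne_zero.2
      ⟨a * c, mul_ne_zero ha hc, ?_⟩⟩, Subtype.ext hy⟩
    rw [mul_smul, hy, hax]

/-- The torsion submodule is a direct summand with complement `Kⁿ`: a maximal linearly independent
subset of a generating family of `F` gives an embedding of `Kⁿ`. -/
theorem IsDivisible.exists_isCompl_torsion [IsLocalRing R] [IsNoetherianRing R] (K : Type*)
    [Field K] [Algebra R K] [IsFractionRing R K] (hD : IsDivisible R D) {r : R} (hr0 : r ≠ 0)
    (hr : r ∈ maximalIdeal R) {F : Submodule R D} (hF : F.FG) (hart : IsArtinian R (D ⧸ F)) :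
    ∃ (D₂ : Submodule R D) (n : ℕ), IsCompl (Submodule.torsion R D) D₂ ∧
      Nonempty (D₂ ≃ₗ[R] (Fin n → K)) := by
  classical
  have := hD.isArtinian_torsion hF hart
  have htors : ∀ a : R, a ≠ 0 → IsArtinian R (Submodule.torsionBy R D a) := fun a ha =>
    isArtinian_of_le (t := Submodule.torsion R D) fun x hx =>
      mem_torsion_iff_exists_ne_zero.2 ⟨a, ha, (Submodule.mem_torsionBy_iff _ _).1 hx⟩
  obtain ⟨m, v, rfl⟩ := Submodule.fg_iff_exists_fin_generating_family.1 hF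
  obtain ⟨s, hs, hmax⟩ := exists_maximal_linearIndepOn R v
  have hex : ∀ i : s, ∃ f : K →ₗ[R] D, f 1 = v i := fun i =>
    exists_linearMap_apply_one_eq K hD htors (v i)
  choose f hf using hex
  let φ : (s → K) →ₗ[R] D := ∑ i, f i ∘ₗ LinearMap.proj i
  have hφ : ∀ k, φ k = ∑ i, f i (k i) := fun k => by
    simp only [φ, LinearMap.sum_apply, LinearMap.comp_apply, LinearMap.proj_apply]
  have hK : ∀ (a : R) (k : s → K), a ≠ 0 → a • k = 0 → k = 0 := by
    intro a k ha hak
    funext i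
    have h1 : a • k i = 0 := congrFun hak i
    rw [Algebra.smul_def, mul_eq_zero] at h1
    exact h1.resolve_left ((map_ne_zero_iff _ (IsFractionRing.injective R K)).2 ha)
  have hinj : ∀ k, φ k = 0 → k = 0 := by
    intro k hk
    obtain ⟨b, hb⟩ := IsLocalization.exist_integer_multiples_of_finite (nonZeroDivisors R) k
    choose a ha using hb
    refine hK b k (nonZeroDivisors.ne_zero b.2) (funext fun i => ?_)
    have h1 : ∑ i, a i • v i = 0 := by
      rw [← smul_zero (b : R), ← hk, ← map_smul, hφ]
      refine Finset.sum_congr rfl fun i _ => ?_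
      rw [Pi.smul_apply, ← ha, Algebra.algebraMap_eq_smul_one, map_smul, hf]
    have h2 := Fintype.linearIndependent_iff.1 hs a h1 i
    rw [Pi.smul_apply, ← ha, h2, map_zero, Pi.zero_apply]
  have hdiv : ∀ b : R, b ≠ 0 → ∀ y ∈ LinearMap.range φ, ∃ z ∈ LinearMap.range φ, b • z = y := by
    rintro b hb _ ⟨k, rfl⟩
    have hb' : algebraMap R K b ≠ 0 := (map_ne_zero_iff _ (IsFractionRing.injective R K)).2 hb
    refine ⟨φ fun i => (algebraMap R K b)⁻¹ * k i, ⟨_, rfl⟩, ?_⟩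
    rw [← map_smul]
    congr 1
    funext i
    rw [Pi.smul_apply, Algebra.smul_def, mul_inv_cancel_left₀ hb']
  have hspan : Submodule.span R (v '' s) ≤ LinearMap.range φ := by
    rw [Submodule.span_le]
    rintro _ ⟨i, hi, rfl⟩
    refine ⟨Pi.single ⟨i, hi⟩ 1, ?_⟩
    rw [hφ, Finset.sum_eq_single ⟨i, hi⟩, Pi.single_eq_same, hf]
    · intro j _ hj
      rw [Pi.single_eq_of_ne hj, map_zero]
    · exact fun h => absurd (Finset.mem_univ _) h
  have hFspan : ∀ x ∈ Submodule.span R (Set.range v), ∃ a : R, a ≠ 0 ∧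
      a • x ∈ Submodule.span R (v '' s) := by
    intro x hx
    induction hx using Submodule.span_induction with
    | mem x hx =>
      obtain ⟨i, rfl⟩ := hx
      by_cases hi : i ∈ s
      · exact ⟨1, one_ne_zero, by rw [one_smul]; exact Submodule.subset_span ⟨i, hi, rfl⟩⟩
      · exact hmax i hi
    | zero => exact ⟨1, one_ne_zero, by rw [smul_zero]; exact zero_mem _⟩
    | add x y _ _ ihx ihy =>
      obtain ⟨a, ha, hax⟩ := ihx
      obtain ⟨b, hb, hby⟩ := ihy
      refine ⟨a * b, mul_ne_zero ha hb, ?_⟩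
      rw [smul_add, mul_smul a b y, mul_comm, mul_smul]
      exact add_mem (Submodule.smul_mem _ _ hax) (Submodule.smul_mem _ _ hby)
    | smul c x _ ih =>
      obtain ⟨a, ha, hax⟩ := ih
      exact ⟨a, ha, by rw [smul_comm]; exact Submodule.smul_mem _ _ hax⟩
  refine ⟨LinearMap.range φ, Fintype.card s, ⟨?_, ?_⟩, ?_⟩
  · rw [Submodule.disjoint_def]
    rintro _ hx ⟨k, rfl⟩
    obtain ⟨a, ha, hak⟩ := mem_torsion_iff_exists_ne_zero.1 hx
    rw [hK a k ha (hinj _ (by rw [map_smul, hak])), map_zero]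
  · rw [codisjoint_iff_le_sup]
    intro x _
    obtain ⟨j, hj⟩ := exists_pow_smul_eq_zero_of_isArtinian hr
      (Submodule.Quotient.mk (p := Submodule.span R (Set.range v)) x)
    rw [← Submodule.Quotient.mk_smul, Submodule.Quotient.mk_eq_zero] at hj
    obtain ⟨a, ha, hax⟩ := hFspan _ hj
    have hne : a * r ^ j ≠ 0 := mul_ne_zero ha (pow_ne_zero j hr0)
    obtain ⟨z, hz, hzx⟩ := hdiv _ hne _ (hspan hax)
    rw [← sub_add_cancel x z]
    refine Submodule.add_mem_sup (mem_torsion_iff_exists_ne_zero.2 ⟨_, hne, ?_⟩) hz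
    rw [smul_sub, hzx, mul_smul, sub_self]
  · have hinj' : Function.Injective φ := LinearMap.ker_eq_bot.1 (LinearMap.ker_eq_bot'.2 hinj)
    exact ⟨(LinearEquiv.ofInjective φ hinj').symm.trans
      (LinearEquiv.funCongrLeft R K (Fintype.equivFin s).symm)⟩

end

end SupplementedModule

theorem mainTheorem5 {R K M : Type*} [CommRing R] [IsDomain R] [IsLocalRing R]
    [IsNoetherianRing R] [Field K] [Algebra R K] [IsFractionRing R K]
    (hRK : ¬ Function.Surjective (algebraMap R K))
    [AddCommGroup M] [Module R M] (hM : SupplementedModule.IsComplemented R M) :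
    (∃ M₁ M₂ : Submodule R M, SupplementedModule.IsBounded R M₁ ∧ M₂.FG ∧
      M₁ ⊔ M₂ ⊔ SupplementedModule.divisiblePart R M = ⊤) ∧
    ∃ (D₁ D₂ : Submodule R (SupplementedModule.divisiblePart R M)) (n : ℕ),
      IsCompl D₁ D₂ ∧ IsArtinian R D₁ ∧ Nonempty (D₂ ≃ₗ[R] (Fin n → K)) := by
  obtain ⟨r, hr0, hr⟩ : ∃ r : R, r ≠ 0 ∧ r ∈ IsLocalRing.maximalIdeal R := by
    by_contra! hunit
    refine hRK fun k => ?_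
    obtain ⟨a, b, hb, rfl⟩ := IsFractionRing.div_surjective (A := R) k
    have hb0 := nonZeroDivisors.ne_zero hb
    obtain ⟨c, hc⟩ := (IsLocalRing.notMem_maximalIdeal.1 (hunit b hb0)).exists_right_inv
    refine ⟨a * c, ?_⟩
    rw [eq_div_iff ((map_ne_zero_iff _ (IsFractionRing.injective R K)).2 hb0), ← map_mul, mul_assoc,
      mul_comm c, hc, mul_one]
  obtain ⟨V, c, hc, hfg, hart, hsup⟩ := hM.exists_sup_divisiblePart_eq_top hr0 hr
  obtain ⟨M₁, M₂, h₁, h₂, rfl⟩ := SupplementedModule.exists_bounded_sup_fg_eq hc hfg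
  refine ⟨⟨M₁, M₂, h₁, h₂, hsup⟩, ?_⟩
  set D := SupplementedModule.divisiblePart R M
  have hD : SupplementedModule.IsDivisible R D :=
    (SupplementedModule.isGreatest_divisiblePart R M).1
  let S : Submodule R D := (M₁ ⊔ M₂).comap D.subtype
  have hS : IsArtinian R (D ⧸ S) := by
    have h := SupplementedModule.isArtinian_quotient_ker ((M₁ ⊔ M₂).mkQ ∘ₗ D.subtype)
    rwa [LinearMap.ker_comp, Submodule.ker_mkQ] at h
  -- `D ⧸ cS` is the image of `D ⧸ S` under multiplication by `c`, as `cD = D`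
  let F : Submodule R D := S.map (LinearMap.lsmul R D c)
  have hF : F.FG := by
    refine Submodule.fg_of_fg_map_injective D.subtype D.injective_subtype (hfg.of_le ?_)
    rintro _ ⟨_, ⟨x, hx, rfl⟩, rfl⟩
    exact ⟨x, hx, rfl⟩
  have hDF : IsArtinian R (D ⧸ F) := by
    refine isArtinian_of_surjective _
      (S.mapQ F (LinearMap.lsmul R D c) (Submodule.le_comap_map _ _)) fun q => ?_
    obtain ⟨x, rfl⟩ := F.mkQ_surjective q
    obtain ⟨y, rfl⟩ := hD c hc x
    exact ⟨S.mkQ y, rfl⟩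
  obtain ⟨D₂, n, hcompl, he⟩ := hD.exists_isCompl_torsion K hr0 hr hF hDF
  exact ⟨_, D₂, n, hcompl, hD.isArtinian_torsion hF hDF, he⟩
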